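/- Let $b\in\{N,D\}$ (Neumann, Dirichlet). Let $\mu$ and $\mu_n$ ($n\in\mathbb N$) be non-atomic Borel probability measures on $[0,1]$ with $0,1\in\operatorname{supp}(\mu)$, $0,1\in\operatorname{supp}(\mu_n)$, $\operatorname{supp}(\mu)\subseteq\operatorname{supp}(\mu_n)$ for all $n$, and $\mu_n\rightharpoonup\mu$ weakly as $n\to\infty$. For such a measure $\nu$, let $\Delta_\nu^b$ be the operator on the real Hilbert space $L^2([0,1],\nu)$ with $h\in\mathcal D(\Delta_\nu^b)$ and $\Delta_\nu^b h=g$ if and only if $h$ has a representative $\bar h\in C^1([0,1])$ with $\bar h'(x)=\bar h'(0)+\int_0^x g\,d\nu$ for all $x\in[0,1]$, and with $\bar h'(0)=\bar h'(1)=0$ if $b=N$, respectively $\bar h(0)=\bar h(1)=0$ if $b=D$. Let $(T_{t}^{b,\nu})_{t\ge 0}$ be the strongly continuous semigroup on $L^2([0,1],\nu)$ whose infinitesimal generator is $\Delta_\nu^b$. Let $(C[0,1])_\nu^b$ be the space of all classes in $L^2([0,1],\nu)$ that have a continuous representative (one that vanishes at $0$ and $1$, if $b=D$), with the norm $\|h\|_\infty=\sup_{x\in\operatorname{supp}(\nu)}|\bar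 h(x)|$, where $\bar h$ is a continuous representative of $h$. Let $\bar\Delta_\nu^b$ be the part of $\Delta_\nu^b$ in $(C[0,1])_\nu^b$, that is, the restriction of $\Delta_\nu^b$ to $\{h\in\mathcal D(\Delta_\nu^b):\Delta_\nu^b h\in(C[0,1])_\nu^b\}$. Let $\pi_n:(C[0,1])_\mu^b\to(C[0,1])_{\mu_n}^b$ map $h$ to the $\mu_n$-class of the continuous representative of $h$ that is linear on every component of $[0,1]\setminus\operatorname{supp}(\mu)$. For a normed space $X$, an operator $A:\mathcal D(A)\subseteq X\to X$ and $x\in X$, a solution of $\frac{du}{dt}(t)=Au(t)$, $u(0)=x$, is a continuous map $u:[0,\infty)\to X$ with $u(0)=x$ such that for all $t>0$ one has $u(t)\in\mathcal D(A)$ and $\lim_{h\to0}\frac{u(t+h)-u(t)}h=Au(t)$ in $X$. **Theorem.** Let $f\in(C[0,1])_\mu^b$. The operators $\Delta_\mu^b$ and $\Delta_{\mu_n}^b$ do generate strongly continuous semigroups as above. The problem $$\frac{du}{dt}(t)=\bar\Delta_\mu^b u(t),\qquad u(0)=f,$$ in $(C[0,1])_\mu^b$ has exactly one solution $u$, namely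 $u(t)=T_t^{b,\mu}f$ for $t\ge0$. For every $n$, the problem $$\frac{du_n}{dt}(t)=\bar\Delta_{\mu_n}^b u_n(t),\qquad u_n(0)=\pi_n f,$$ in $(C[0,1])_{\mu_n}^b$ has exactly one solution $u_n$, namely $u_n(t)=T_t^{b,\mu_n}\pi_n f$ for $t\ge 0$. Moreover, $$\lim_{n\to\infty}\|\pi_n u(t)-u_n(t)\|_\infty=0,$$ uniformly for $t$ in bounded subsets of $[0,\infty)$. -/

import Mathlib

open MeasureTheory Filter Topology Set
open scoped unitInterval NNReal

noncomputable section

namespace KreinFeller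

/-! ### Mass distributions and boundary conditions -/

/-- A non-atomic Borel probability measure on `[0,1]` whose support contains `0` and `1`. -/
structure MassDistribution where
  prob : ProbabilityMeasure I
  measure_singleton : ∀ x : I, (prob : Measure I) {x} = 0
  zero_mem : (0 : I) ∈ (prob : Measure I).support
  one_mem : (1 : I) ∈ (prob : Measure I).support

/-- The underlying Borel measure on `[0,1]`. -/
abbrev MassDistribution.meas (μ : MassDistribution) : Measure I := (μ.prob : Measure I)

/-- The (closed) support of the mass distribution. -/
abbrev MassDistribution.supp (μ : MassDistribution) : Set I := μ.meas.support

/-- The real Hilbert space `L²([0,1], μ)`. -/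
abbrev MassDistribution.L2 (μ : MassDistribution) : Type := Lp ℝ 2 μ.meas

/-- Neumann or Dirichlet boundary conditions. -/
inductive BoundaryCondition where
  | neumann
  | dirichlet

/-- The boundary condition imposed on elements of the operator domain: the derivative `F'`
vanishes at `0` and `1` (Neumann), or `F` vanishes at `0` and `1` (Dirichlet). -/
def BoundaryCondition.OnDomain (b : BoundaryCondition) (F F' : C(I, ℝ)) : Prop :=
  match b with
  | neumann => F' 0 = 0 ∧ F' 1 = 0
  | dirichlet => F 0 = 0 ∧ F 1 = 0

/-- The boundary condition imposed on continuous functions: none (Neumann), or vanishing at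
`0` and `1` (Dirichlet). -/
def BoundaryCondition.OnContinuous (b : BoundaryCondition) (F : C(I, ℝ)) : Prop :=
  match b with
  | neumann => True
  | dirichlet => F 0 = 0 ∧ F 1 = 0

/-! ### The Krein-Feller operator -/

/-- The Krein-Feller operator `Δ_μ^b` on `L²([0,1], μ)`, as its graph: `f` lies in the domain and
`g = Δ_μ^b f` if and only if `f` has a `C¹` representative `F` (with derivative `F'`, one-sided at
the end points) which satisfies the boundary condition and
`F'(x) = F'(0) + ∫_{[0,x]} g dμ` for all `x ∈ [0,1]`. -/
def kreinFeller (μ : MassDistribution) (b : BoundaryCondition) : Set (μ.L2 × μ.L2) :=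
  {p | ∃ F F' : C(I, ℝ),
    (F : I → ℝ) =ᵐ[μ.meas] p.1 ∧
    (∀ x : I, HasDerivWithinAt (IccExtend zero_le_one F) (F' x) (Icc (0 : ℝ) 1) x) ∧
    (∀ x : I, F' x = F' 0 + ∫ y in Iic x, p.2 y ∂μ.meas) ∧
    b.OnDomain F F'}

/-! ### Strongly continuous semigroups and abstract Cauchy problems -/

/-- `T` is a strongly continuous semigroup of bounded operators on `X`. -/
structure IsC0Semigroup {X : Type*} [NormedAddCommGroup X] [NormedSpace ℝ X]
    (T : ℝ≥0 → X →L[ℝ] X) : Prop where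
  map_zero : T 0 = ContinuousLinearMap.id ℝ X
  map_add : ∀ s t, T (s + t) = (T s).comp (T t)
  continuous_orbit : ∀ x, Continuous fun t => T t x

/-- The infinitesimal generator of `T`, as its graph: `x` lies in the domain with value `y` if and
only if `(T_t x - x) / t → y` as `t ↓ 0`. -/
def generator {X : Type*} [NormedAddCommGroup X] [NormedSpace ℝ X]
    (T : ℝ≥0 → X →L[ℝ] X) : Set (X × X) :=
  {p | Tendsto (fun t : ℝ≥0 => (t : ℝ)⁻¹ • (T t p.1 - p.1)) (𝓝[>] 0) (𝓝 p.2)}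

/-- The operator with graph `A` is the infinitesimal generator of the strongly continuous
semigroup `T`. -/
def Generates {X : Type*} [NormedAddCommGroup X] [NormedSpace ℝ X]
    (A : Set (X × X)) (T : ℝ≥0 → X →L[ℝ] X) : Prop :=
  IsC0Semigroup T ∧ generator T = A

/-- `u : [0,∞) → X` solves `du/dt = A u`, `u(0) = f`, where `A` is given by its graph: `u` is
continuous on `[0,∞)`, and for every `t > 0` one has `u(t) ∈ D(A)` and
`lim_{h → 0} (u(t+h) - u(t)) / h = A u(t)` in `X`. -/
structure IsSolution {X : Type*} [NormedAddCommGroup X] [NormedSpace ℝ X]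
    (A : Set (X × X)) (f : X) (u : ℝ≥0 → X) : Prop where
  continuous : Continuous u
  initial : u 0 = f
  equation : ∀ t : ℝ≥0, 0 < t → ∃ v : X, (u t, v) ∈ A ∧
    HasDerivAt (fun s : ℝ => u s.toNNReal) v (t : ℝ)

/-! ### The space of classes with a continuous representative -/

/-- The set of `L²([0,1], μ)`-classes possessing a continuous representative, which in the
Dirichlet case vanishes at `0` and `1`. -/
def contSubmodule (μ : MassDistribution) (b : BoundaryCondition) : Submodule ℝ μ.L2 where
  carrier := {f | ∃ F : C(I, ℝ), (F : I → ℝ) =ᵐ[μ.meas] f ∧ b.OnContinuous F}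
  zero_mem' := by
    refine ⟨0, ?_, ?_⟩
    · filter_upwards [Lp.coeFn_zero ℝ 2 μ.meas] with x hx
      rw [hx]; rfl
    · cases b <;> simp [BoundaryCondition.OnContinuous]
  add_mem' := by
    rintro f g ⟨F, hF, hF'⟩ ⟨G, hG, hG'⟩
    refine ⟨F + G, ?_, ?_⟩
    · filter_upwards [Lp.coeFn_add f g, hF, hG] with x hx h1 h2
      rw [hx]; simp [h1, h2]
    · cases b <;> simp_all [BoundaryCondition.OnContinuous]
  smul_mem' := by
    rintro c f ⟨F, hF, hF'⟩
    refine ⟨c • F, ?_, ?_⟩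
    · filter_upwards [Lp.coeFn_smul c f, hF] with x hx h1
      rw [hx]; simp [h1]
    · cases b <;> simp_all [BoundaryCondition.OnContinuous]

/-- The space `(C[0,1])_μ^b`; its norm, defined below, is the uniform norm on the support. -/
def CSpace (μ : MassDistribution) (b : BoundaryCondition) : Type := contSubmodule μ b

namespace CSpace

variable {μ : MassDistribution} {b : BoundaryCondition}

instance : AddCommGroup (CSpace μ b) := inferInstanceAs (AddCommGroup (contSubmodule μ b))
instance : Module ℝ (CSpace μ b) := inferInstanceAs (Module ℝ (contSubmodule μ b))

/-- The inclusion of `(C[0,1])_μ^b` into `L²([0,1], μ)`. -/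
def toL2 : CSpace μ b →ₗ[ℝ] μ.L2 := (contSubmodule μ b).subtype

/-- Some continuous representative (its values on the support do not depend on the choice). -/
def rep (f : CSpace μ b) : C(I, ℝ) := f.2.choose

theorem rep_ae (f : CSpace μ b) : (f.rep : I → ℝ) =ᵐ[μ.meas] toL2 f := f.2.choose_spec.1

theorem rep_onContinuous (f : CSpace μ b) : b.OnContinuous f.rep := f.2.choose_spec.2

theorem eqOn_supp {F G : C(I, ℝ)} (h : (F : I → ℝ) =ᵐ[μ.meas] G) : EqOn F G μ.supp := by
  intro x hx
  by_contra hne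
  have hopen : IsOpen {y | F y ≠ G y} := isOpen_ne_fun F.continuous G.continuous
  have hpos := (Measure.mem_support_iff_forall x).1 hx _ (hopen.mem_nhds hne)
  exact hpos.ne' (ae_iff.1 h)

theorem ae_of_eqOn_supp {F G : C(I, ℝ)} (h : EqOn F G μ.supp) : (F : I → ℝ) =ᵐ[μ.meas] G := by
  filter_upwards [Measure.support_mem_ae (μ := μ.meas)] with x hx using h hx

instance : CompactSpace μ.supp := isCompact_iff_compactSpace.1 Measure.isClosed_support.isCompact

/-- The restriction of the continuous representative to the support of `μ`. -/
def restrictSupp : CSpace μ b →ₗ[ℝ] C(μ.supp, ℝ) where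
  toFun f := f.rep.restrict μ.supp
  map_add' f g := by
    ext x
    refine eqOn_supp (μ := μ) (F := (f + g).rep) (G := f.rep + g.rep) ?_ x.2
    have h := Lp.coeFn_add (toL2 f) (toL2 g)
    rw [← map_add] at h
    filter_upwards [rep_ae (f + g), rep_ae f, rep_ae g, h] with y h1 h2 h3 h4
    rw [h1, h4]; simp [h2, h3]
  map_smul' c f := by
    ext x
    refine eqOn_supp (μ := μ) (F := (c • f).rep) (G := c • f.rep) ?_ x.2
    have h := Lp.coeFn_smul c (toL2 f)
    rw [← map_smul] at h
    filter_upwards [rep_ae (c • f), rep_ae f, h] with y h1 h2 h4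
    rw [h1, h4]; simp [h2]

theorem restrictSupp_injective :
    Function.Injective (restrictSupp : CSpace μ b → C(μ.supp, ℝ)) := by
  intro f g hfg
  have h : EqOn f.rep g.rep μ.supp := fun x hx => DFunLike.congr_fun hfg ⟨x, hx⟩
  refine Subtype.ext (Lp.ext ?_)
  exact (rep_ae f).symm.trans ((ae_of_eqOn_supp h).trans (rep_ae g))

/-- The norm of `f` is the uniform norm on `supp μ` of its continuous representative. -/
instance : NormedAddCommGroup (CSpace μ b) :=
  NormedAddCommGroup.induced (CSpace μ b) C(μ.supp, ℝ) restrictSupp restrictSupp_injective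

instance : NormedSpace ℝ (CSpace μ b) :=
  NormedSpace.induced ℝ (CSpace μ b) C(μ.supp, ℝ) restrictSupp

end CSpace

/-- The part of the Krein-Feller operator in `(C[0,1])_μ^b`, as its graph: its domain consists of
the `f ∈ D(Δ_μ^b)` with `Δ_μ^b f ∈ (C[0,1])_μ^b`. -/
def kreinFellerBar (μ : MassDistribution) (b : BoundaryCondition) :
    Set (CSpace μ b × CSpace μ b) :=
  {p | (CSpace.toL2 p.1, CSpace.toL2 p.2) ∈ kreinFeller μ b}

/-! ### Linear interpolation in the gaps of the support -/

/-- The largest point of the closed set `S` to the left of `x`. -/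
def gapLeft (S : Set I) (x : I) : I := sSup (S ∩ Iic x)

/-- The smallest point of the closed set `S` to the right of `x`. -/
def gapRight (S : Set I) (x : I) : I := sInf (S ∩ Ici x)

/-- The function that agrees with `F` on `S` (where `gapLeft S x = gapRight S x = x`) and is linear
on every component of the complement of `S`. -/
def gapLinear (S : Set I) (F : I → ℝ) (x : I) : ℝ :=
  F (gapLeft S x) + (F (gapRight S x) - F (gapLeft S x)) *
    (((x : ℝ) - gapLeft S x) / ((gapRight S x : ℝ) - gapLeft S x))

theorem gapLeft_le (S : Set I) (x : I) : gapLeft S x ≤ x := sSup_le fun _ h => h.2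

theorem le_gapRight (S : Set I) (x : I) : x ≤ gapRight S x := le_sInf fun _ h => h.2

theorem le_gapLeft {S : Set I} {x s : I} (hs : s ∈ S) (h : s ≤ x) : s ≤ gapLeft S x :=
  le_sSup ⟨hs, h⟩

theorem gapRight_le {S : Set I} {x s : I} (hs : s ∈ S) (h : x ≤ s) : gapRight S x ≤ s :=
  sInf_le ⟨hs, h⟩

theorem gapLinear_of_mem {S : Set I} (F : I → ℝ) {x : I} (hx : x ∈ S) :
    gapLinear S F x = F x := by
  have h1 : gapLeft S x = x := le_antisymm (gapLeft_le S x) (le_gapLeft hx le_rfl)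
  simp [gapLinear, h1]

theorem gapLeft_mem {S : Set I} (hS : IsClosed S) (h0 : (0 : I) ∈ S) (x : I) :
    gapLeft S x ∈ S :=
  ((hS.inter isClosed_Iic).csSup_mem ⟨0, h0, x.2.1⟩ (OrderTop.bddAbove _)).1

theorem gapRight_mem {S : Set I} (hS : IsClosed S) (h1 : (1 : I) ∈ S) (x : I) :
    gapRight S x ∈ S :=
  ((hS.inter isClosed_Ici).csInf_mem ⟨1, h1, x.2.2⟩ (OrderBot.bddBelow _)).1

theorem gapLinear_mem {S : Set I} {F : I → ℝ} {K : Set ℝ} (hK : Convex ℝ K) {x : I}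
    (hl : F (gapLeft S x) ∈ K) (hr : F (gapRight S x) ∈ K) : gapLinear S F x ∈ K := by
  have h1 : (gapLeft S x : ℝ) ≤ x := gapLeft_le S x
  have h2 : (x : ℝ) ≤ gapRight S x := le_gapRight S x
  set θ := ((x : ℝ) - gapLeft S x) / ((gapRight S x : ℝ) - gapLeft S x) with hθ
  have h3 : 0 ≤ θ := div_nonneg (by linarith) (by linarith)
  have h4 : θ ≤ 1 := div_le_one_of_le₀ (by linarith) (by linarith)
  have := hK hl hr (sub_nonneg.2 h4) h3 (by ring)
  convert this using 1
  simp only [gapLinear, ← hθ, smul_eq_mul]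
  ring

/-- On a set where the neighbouring points of `S` are constant, the interpolation is continuous. -/
theorem gapLinear_tendsto {S : Set I} (F : I → ℝ) {l r x : I} {U : Set I}
    (hU : ∀ y ∈ U, gapLeft S y = l ∧ gapRight S y = r)
    (hx : gapLinear S F x = F l + (F r - F l) * (((x : ℝ) - l) / ((r : ℝ) - l))) :
    Tendsto (gapLinear S F) (𝓝[U] x) (𝓝 (gapLinear S F x)) := by
  have hc : Continuous fun y : I => F l + (F r - F l) * (((y : ℝ) - l) / ((r : ℝ) - l)) := by
    fun_prop
  rw [hx]
  refine ((hc.tendsto x).mono_left nhdsWithin_le_nhds).congr' ?_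
  filter_upwards [self_mem_nhdsWithin] with y hy
  simp [gapLinear, (hU y hy).1, (hU y hy).2]

theorem continuous_gapLinear {S : Set I} (hS : IsClosed S) (h0 : (0 : I) ∈ S) (h1 : (1 : I) ∈ S)
    {F : I → ℝ} (hF : Continuous F) : Continuous (gapLinear S F) := by
  rw [continuous_iff_continuousAt]
  intro x
  by_cases hx : x ∈ S
  · rw [continuousAt_iff_continuous_left'_right']
    constructor
    · by_cases h : ∃ u, u < x ∧ ∀ s ∈ S, u < s → s < x → False
      · obtain ⟨u, hu, hS'⟩ := h
        rw [ContinuousWithinAt, ← nhdsWithin_Ioo_eq_nhdsLT hu]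
        refine gapLinear_tendsto F (l := gapLeft S u) (r := x) (fun y hy => ⟨?_, ?_⟩) ?_
        · refine le_antisymm ?_ (le_gapLeft (gapLeft_mem hS h0 u) ((gapLeft_le S u).trans hy.1.le))
          refine le_gapLeft (gapLeft_mem hS h0 y) (not_lt.1 fun hlt => ?_)
          exact hS' _ (gapLeft_mem hS h0 y) hlt ((gapLeft_le S y).trans_lt hy.2)
        · refine le_antisymm (gapRight_le hx hy.2.le) (not_lt.1 fun hlt => ?_)
          exact hS' _ (gapRight_mem hS h1 y) (hy.1.trans_le (le_gapRight S y)) hlt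
        · have : (gapLeft S u : ℝ) < x := (gapLeft_le S u).trans_lt hu
          rw [gapLinear_of_mem F hx, div_self (sub_ne_zero.2 this.ne')]
          ring
      · push Not at h
        rw [ContinuousWithinAt, Metric.tendsto_nhds]
        intro ε hε
        rw [gapLinear_of_mem F hx]
        have hev : ∀ᶠ y in 𝓝[≤] x, dist (F y) (F x) < ε :=
          ((Metric.tendsto_nhds.1 (hF.tendsto x)) ε hε).filter_mono nhdsWithin_le_nhds
        rcases eq_or_ne x 0 with rfl | hx0
        · have : Iio (0 : I) = ∅ := by ext z; simp
          rw [this]; simp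
        obtain ⟨u, hu, hU⟩ := (mem_nhdsLE_iff_exists_Ioc_subset'
          (unitInterval.pos_iff_ne_zero.2 hx0)).1 hev
        obtain ⟨s, hs, hus, hsx, -⟩ := h u hu
        filter_upwards [Ioo_mem_nhdsLT hsx] with y hy
        refine gapLinear_mem (convex_ball (F x) ε) (hU ⟨?_, ?_⟩) (hU ⟨?_, ?_⟩)
        · exact hus.trans_le (le_gapLeft hs hy.1.le)
        · exact (gapLeft_le S y).trans hy.2.le
        · exact (hus.trans hy.1).trans_le (le_gapRight S y)
        · exact gapRight_le hx hy.2.le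
    · by_cases h : ∃ u, x < u ∧ ∀ s ∈ S, x < s → s < u → False
      · obtain ⟨u, hu, hS'⟩ := h
        rw [ContinuousWithinAt, ← nhdsWithin_Ioo_eq_nhdsGT hu]
        refine gapLinear_tendsto F (l := x) (r := gapRight S u) (fun y hy => ⟨?_, ?_⟩) ?_
        · refine le_antisymm (not_lt.1 fun hlt => ?_) (le_gapLeft hx hy.1.le)
          exact hS' _ (gapLeft_mem hS h0 y) hlt ((gapLeft_le S y).trans_lt hy.2)
        · refine le_antisymm (gapRight_le (gapRight_mem hS h1 u)
            (hy.2.le.trans (le_gapRight S u))) ?_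
          refine gapRight_le (gapRight_mem hS h1 y) (not_lt.1 fun hlt => ?_)
          exact hS' _ (gapRight_mem hS h1 y) (hy.1.trans_le (le_gapRight S y)) hlt
        · rw [gapLinear_of_mem F hx]
          simp
      · push Not at h
        rw [ContinuousWithinAt, Metric.tendsto_nhds]
        intro ε hε
        rw [gapLinear_of_mem F hx]
        have hev : ∀ᶠ y in 𝓝[≥] x, dist (F y) (F x) < ε :=
          ((Metric.tendsto_nhds.1 (hF.tendsto x)) ε hε).filter_mono nhdsWithin_le_nhds
        rcases eq_or_ne x 1 with rfl | hx0
        · have : Ioi (1 : I) = ∅ := by ext z; simpa using (show z ≤ 1 from z.2.2)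
          rw [this]; simp
        obtain ⟨u, hu, hU⟩ := (mem_nhdsGE_iff_exists_Ico_subset'
          (unitInterval.lt_one_iff_ne_one.2 hx0)).1 hev
        obtain ⟨s, hs, hxs, hsu, -⟩ := h u hu
        filter_upwards [Ioo_mem_nhdsGT hxs] with y hy
        refine gapLinear_mem (convex_ball (F x) ε) (hU ⟨?_, ?_⟩) (hU ⟨?_, ?_⟩)
        · exact le_gapLeft hx hy.1.le
        · exact (gapLeft_le S y).trans_lt (hy.2.trans hsu)
        · exact hy.1.le.trans (le_gapRight S y)
        · exact (gapRight_le hs hy.2.le).trans_lt hsu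
  · have hl : gapLeft S x < x :=
      (gapLeft_le S x).lt_of_ne fun h => hx (h ▸ gapLeft_mem hS h0 x)
    have hr : x < gapRight S x :=
      (le_gapRight S x).lt_of_ne fun h => hx (h ▸ gapRight_mem hS h1 x)
    have hnhds : 𝓝[Ioo (gapLeft S x) (gapRight S x)] x = 𝓝 x :=
      isOpen_Ioo.nhdsWithin_eq ⟨hl, hr⟩
    rw [ContinuousAt, ← hnhds]
    refine gapLinear_tendsto F (fun y hy => ⟨?_, ?_⟩) rfl
    · refine le_antisymm ?_ (le_gapLeft (gapLeft_mem hS h0 x) hy.1.le)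
      refine le_gapLeft (gapLeft_mem hS h0 y) (not_lt.1 fun hlt => ?_)
      exact absurd (gapRight_le (gapLeft_mem hS h0 y) hlt.le)
        (not_le.2 ((gapLeft_le S y).trans_lt hy.2))
    · refine le_antisymm (gapRight_le (gapRight_mem hS h1 x) hy.2.le) ?_
      refine gapRight_le (gapRight_mem hS h1 y) (not_lt.1 fun hlt => ?_)
      exact absurd (le_gapLeft (gapRight_mem hS h1 y) hlt.le)
        (not_le.2 (hy.1.trans_le (le_gapRight S y)))

namespace CSpace

variable {μ : MassDistribution} {b : BoundaryCondition}

/-- The continuous representative of `f` that is linear on all gaps of the support of `μ`. -/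
def linearRep (f : CSpace μ b) : C(I, ℝ) :=
  ⟨gapLinear μ.supp f.rep,
    continuous_gapLinear Measure.isClosed_support μ.zero_mem μ.one_mem f.rep.continuous⟩

theorem linearRep_onContinuous (f : CSpace μ b) : b.OnContinuous f.linearRep := by
  have h := f.rep_onContinuous
  cases b
  · trivial
  · exact ⟨(gapLinear_of_mem _ μ.zero_mem).trans h.1, (gapLinear_of_mem _ μ.one_mem).trans h.2⟩

end CSpace

/-- The embedding of `(C[0,1])_μ^b` into `(C[0,1])_ν^b` (an embedding if `supp μ ⊆ supp ν`): it maps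
`f` to the `ν`-class of the representative of `f` that is linear on all gaps of `supp μ`. -/
def embed (μ ν : MassDistribution) (b : BoundaryCondition) (f : CSpace μ b) : CSpace ν b :=
  ⟨ContinuousMap.toLp 2 ν.meas ℝ f.linearRep, f.linearRep,
    (ContinuousMap.coeFn_toLp ν.meas f.linearRep).symm, f.linearRep_onContinuous⟩

/-! ### The semigroup -/

/-- The semigroup `(T_t^b)` on `L²([0,1], μ)` generated by `Δ_μ^b`. (A strongly continuous semigroup
is determined by its generator.) -/
def heatSemigroup (μ : MassDistribution) (b : BoundaryCondition) : ℝ≥0 → μ.L2 →L[ℝ] μ.L2 :=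
  Classical.epsilon (Generates (kreinFeller μ b))

end KreinFeller

end

open KreinFeller

/-! Everything rests on one notion, dissipativity of a graph: ‖x‖ ≤ ‖x - h y‖ for (x, y) in the
graph and h ≥ 0. It yields an a priori bound for w' = A w + e (`Dissipative.norm_le`), hence
uniqueness, and together with surjectivity of l - A and a dense domain it yields a contraction
semigroup, by Yosida approximation (`Dissipative.exists_generates`).

In L² the operator is symmetric and nonpositive by integration by parts; l - Δ is onto by
Lax-Milgram applied to an explicit inverse of Δ, on the mean-zero functions in the Neumann case. In
the uniform norm on the support, dissipativity of the part of Δ is the weak maximum principle,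
obtained by testing with ((F - K)⁺)². Surjectivity carries over because elements of the domain are
continuous. For density, l(l - Δ)⁻¹F with l large is compared with a C¹ function F: an energy
estimate bounds the L²-distance and the oscillation of the difference, and small balls centred in
the support have mass bounded below, so the difference is uniformly small on the support.

The inclusion into L² intertwines the two semigroups. The self-adjoint semigroup on L² maps into the
domain at every positive time; applied twice, this shows that Δ T_t f is again in the domain, hence
continuous, so the orbit of every continuous f solves the Cauchy problem.

Convergence follows from a Trotter-Kato theorem on varying spaces (`trotter_kato`), which reduces it
to convergence of resolvents (`tendsto_resolvent`). Let F'' = k dμ, with k continuous, be the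
limiting resolvent equation. Replacing the μ-potential of k by its μ_n-potential, with a small
boundary correction, solves the equation for μ_n up to a uniformly small error, because weak
convergence is uniform on the compact family of kernels (x - y)⁺ k(y). Dissipativity for μ_n turns a
small error into a small distance. The C¹ solution F is linear on the gaps of supp μ, so π_n sends
its class to the class of F itself. -/

noncomputable section

namespace KreinFeller

/-! ### Dissipative operators -/

section Dissipative

variable {X : Type*} [NormedAddCommGroup X] [NormedSpace ℝ X]

/-- The operator with graph `A` is dissipative. -/
def Dissipative (A : Submodule ℝ (X × X)) : Prop :=
  ∀ p ∈ A, ∀ h : ℝ, 0 ≤ h → ‖p.1‖ ≤ ‖p.1 - h • p.2‖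

/-- A priori bound for the inhomogeneous equation `w' = A w + e` with `A` dissipative. -/
theorem Dissipative.norm_le {A : Submodule ℝ (X × X)} (hA : Dissipative A) {w y e : ℝ → X}
    {C τ : ℝ} (hτ : 0 ≤ τ) (hw : ContinuousOn w (Icc 0 τ))
    (hd : ∀ t ∈ Ioc 0 τ, (w t, y t) ∈ A ∧ HasDerivAt w (y t + e t) t ∧ ‖e t‖ ≤ C) :
    ‖w τ‖ ≤ ‖w 0‖ + C * τ := by
  -- Time runs backwards from τ: ‖w t‖ ≤ ‖w t - h • y t‖, and w t - h • y t equals w (t - h) + h • e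
  -- t up to o(h). The equation is thus used only on (0, τ], and continuity suffices at 0.
  have key := image_le_of_liminf_slope_right_le_deriv_boundary (f := fun s => -‖w (τ - s)‖)
    (a := 0) (b := τ) (B := fun s => -‖w τ‖ + C * s) (B' := fun _ => C) ?_ (by simp) (by fun_prop)
    (fun x _ => by simpa using (((hasDerivAt_id x).const_mul C).const_add (-‖w τ‖)).hasDerivWithinAt) ?_
    (right_mem_Icc.2 hτ)
  · simp at key; linarith
  · refine (hw.comp (f := fun s => τ - s) (by fun_prop) ?_).norm.neg
    intro s hs; exact ⟨by linarith [hs.2], by linarith [hs.1]⟩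
  · intro s hs r hr
    refine Eventually.frequently ?_
    obtain ⟨hmem, hder, he⟩ := hd (τ - s) ⟨by linarith [hs.2], by linarith [hs.1]⟩
    set t := τ - s with ht
    have hε : 0 < (r - C) / 2 := by linarith
    have h1 := (hasDerivAt_iff_isLittleO.1 hder).def hε
    have h2 : Tendsto (fun z => τ - z) (𝓝[>] s) (𝓝 t) :=
      Tendsto.mono_left (by rw [ht]; exact (continuous_const.sub continuous_id).tendsto s)
        nhdsWithin_le_nhds
    filter_upwards [h2.eventually h1, self_mem_nhdsWithin] with z hz hsz
    have hpos : 0 < z - s := sub_pos.2 hsz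
    have e1 : τ - z - t = -(z - s) := by rw [ht]; ring
    rw [e1, Real.norm_eq_abs, abs_neg, abs_of_pos hpos] at hz
    have h3 := hA _ hmem (z - s) hpos.le
    simp only at h3
    have h4 : w t - (z - s) • y t = w (τ - z) + (z - s) • e t -
        (w (τ - z) - w t - (-(z - s)) • (y t + e t)) := by
      module
    have h5 : ‖w t - (z - s) • y t‖ ≤ ‖w (τ - z)‖ + (z - s) * C + (r - C) / 2 * (z - s) := by
      rw [h4]
      refine (norm_sub_le _ _).trans (add_le_add ((norm_add_le _ _).trans ?_) hz)
      rw [norm_smul, Real.norm_eq_abs, abs_of_pos hpos]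
      gcongr
    rw [slope_def_field, div_lt_iff₀ hpos]
    have : (r - C) / 2 * (z - s) < (r - C) * (z - s) := by
      have := mul_pos hε hpos
      nlinarith
    nlinarith

/-- Two solutions of `u' = A u` with `A` dissipative and the same initial value agree. -/
theorem Dissipative.eq_of_solutions {A : Submodule ℝ (X × X)} (hA : Dissipative A)
    {w₁ w₂ y₁ y₂ : ℝ → X} (h₁ : ContinuousOn w₁ (Ici 0)) (h₂ : ContinuousOn w₂ (Ici 0))
    (h0 : w₁ 0 = w₂ 0)
    (hd₁ : ∀ t, 0 < t → (w₁ t, y₁ t) ∈ A ∧ HasDerivAt w₁ (y₁ t) t)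
    (hd₂ : ∀ t, 0 < t → (w₂ t, y₂ t) ∈ A ∧ HasDerivAt w₂ (y₂ t) t) {t : ℝ} (ht : 0 ≤ t) :
    w₁ t = w₂ t := by
  have := hA.norm_le (w := fun t => w₁ t - w₂ t) (y := fun t => y₁ t - y₂ t) (e := 0) (C := 0) ht
    ((h₁.sub h₂).mono Icc_subset_Ici_self) ?_
  · simpa [h0, sub_eq_zero] using this
  · intro s hs
    refine ⟨A.sub_mem (hd₁ s hs.1).1 (hd₂ s hs.1).1, ?_, by simp⟩
    simpa [Pi.sub_def] using (hd₁ s hs.1).2.sub (hd₂ s hs.1).2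

/-- Dissipativity of p - q with step 1 / l, where the right-hand side vanishes. -/
theorem Dissipative.eq_of_solves {A : Submodule ℝ (X × X)} (hA : Dissipative A) {l : ℝ}
    (hl : 0 < l) {p q : X × X} (hp : p ∈ A) (hq : q ∈ A)
    (h : l • p.1 - p.2 = l • q.1 - q.2) : p = q := by
  have h1 := hA _ (A.sub_mem hp hq) l⁻¹ (inv_nonneg.2 hl.le)
  have h2 : (p - q).1 - l⁻¹ • (p - q).2 = 0 := by
    have : (p - q).1 - l⁻¹ • (p - q).2 = l⁻¹ • ((l • p.1 - p.2) - (l • q.1 - q.2)) := by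
      simp only [Prod.fst_sub, Prod.snd_sub, smul_sub, smul_smul, inv_mul_cancel₀ hl.ne', one_smul]
      abel
    rw [this, h, sub_self, smul_zero]
  rw [h2, norm_zero, norm_le_zero_iff] at h1
  have h3 : p.1 = q.1 := sub_eq_zero.1 h1
  rw [h3, sub_right_inj] at h
  exact Prod.ext h3 h

end Dissipative

/-! ### Orbits of strongly continuous semigroups -/

section Orbits

variable {X : Type*} [NormedAddCommGroup X] [NormedSpace ℝ X] {T : ℝ≥0 → X →L[ℝ] X}

theorem IsC0Semigroup.continuous_orbit_real (hT : IsC0Semigroup T) (x : X) :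
    Continuous fun s : ℝ => T s.toNNReal x :=
  (hT.continuous_orbit x).comp continuous_real_toNNReal

theorem IsC0Semigroup.generator_orbit (hT : IsC0Semigroup T) {x y : X}
    (h : (x, y) ∈ generator T) (t : ℝ≥0) : (T t x, T t y) ∈ generator T := by
  have h1 := ((T t).continuous.tendsto y).comp h
  refine h1.congr fun s => ?_
  simp only [Function.comp, map_smul, map_sub]
  rw [← ContinuousLinearMap.comp_apply, ← hT.map_add, add_comm, hT.map_add]
  rfl

theorem IsC0Semigroup.hasDerivWithinAt_right (hT : IsC0Semigroup T) {x y : X}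
    (h : (x, y) ∈ generator T) {t : ℝ} (ht : 0 ≤ t) :
    HasDerivWithinAt (fun s : ℝ => T s.toNNReal x) (T t.toNNReal y) (Ici t) t := by
  have h1 := hT.generator_orbit h t.toNNReal
  rw [← hasDerivWithinAt_Ioi_iff_Ici, hasDerivWithinAt_iff_tendsto_slope' (by simp)]
  have h2 : Tendsto (fun z : ℝ => (z - t).toNNReal) (𝓝[>] t) (𝓝[>] 0) := by
    refine tendsto_nhdsWithin_iff.2 ⟨?_, ?_⟩
    · have : Continuous fun z : ℝ => (z - t).toNNReal := by fun_prop
      simpa using (this.tendsto t).mono_left nhdsWithin_le_nhds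
    · filter_upwards [self_mem_nhdsWithin] with z hz
      simpa using hz
  refine (Tendsto.comp h1 h2).congr' ?_
  filter_upwards [self_mem_nhdsWithin] with z hz
  have hz' : t ≤ z := le_of_lt hz
  simp only [Function.comp, slope, vsub_eq_sub]
  rw [Real.coe_toNNReal _ (sub_nonneg.2 hz'), ← ContinuousLinearMap.comp_apply, ← hT.map_add,
    ← Real.toNNReal_add (sub_nonneg.2 hz') ht, sub_add_cancel]

/-- The generator only provides right derivatives. Subtracting the integral of the continuous right
derivative leaves a function with zero right derivative, hence a constant, and the integral is
differentiable on both sides. -/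
theorem IsC0Semigroup.hasDerivAt_orbit [CompleteSpace X] (hT : IsC0Semigroup T) {x y : X}
    (h : (x, y) ∈ generator T) {t : ℝ} (ht : 0 < t) :
    HasDerivAt (fun s : ℝ => T s.toNNReal x) (T t.toNNReal y) t := by
  have hy := hT.continuous_orbit_real y
  have hint : ∀ s, HasDerivAt (fun s => ∫ r in (0 : ℝ)..s, T r.toNNReal y) (T s.toNNReal y) s :=
    fun s => intervalIntegral.integral_hasDerivAt_right (hy.intervalIntegrable _ _)
      (hy.stronglyMeasurableAtFilter _ _) hy.continuousAt
  have key : ∀ s ∈ Icc 0 (t + 1), T s.toNNReal x = x + ∫ r in (0 : ℝ)..s, T r.toNNReal y := by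
    intro s hs
    have := constant_of_has_deriv_right_zero
      (f := fun s : ℝ => T s.toNNReal x - ∫ r in (0 : ℝ)..s, T r.toNNReal y) (a := 0) (b := t + 1)
      ((hT.continuous_orbit_real x).sub
        (continuous_iff_continuousAt.2 fun s => (hint s).continuousAt)).continuousOn
      (fun s hs => by
        simpa [Pi.sub_def] using (hT.hasDerivWithinAt_right h hs.1).sub (hint s).hasDerivWithinAt) s hs
    simp only [Real.toNNReal_zero, hT.map_zero, ContinuousLinearMap.coe_id', id_eq,
      intervalIntegral.integral_same, sub_zero] at this
    exact eq_add_of_sub_eq this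
  refine ((hint t).const_add x).congr_of_eventuallyEq ?_
  filter_upwards [Icc_mem_nhds ht (lt_add_one t)] with s hs using key s hs

end Orbits

/-! ### Generation of contraction semigroups -/

section Generation

variable {X : Type*} [NormedAddCommGroup X] [NormedSpace ℝ X]

/-- Pointwise convergence of contractions extends from a dense set. -/
theorem tendsto_of_dense {ι : Type*} {l : Filter ι} {Y : Type*} [NormedAddCommGroup Y]
    [NormedSpace ℝ Y] {L : ι → X →L[ℝ] Y} {S : X →L[ℝ] Y} {K : ℝ}
    (hL : ∀ i x, ‖L i x‖ ≤ K * ‖x‖) (hS : ∀ x, ‖S x‖ ≤ K * ‖x‖) {D : Set X} (hD : Dense D)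
    (h : ∀ x ∈ D, Tendsto (fun i => L i x) l (𝓝 (S x))) (x : X) :
    Tendsto (fun i => L i x) l (𝓝 (S x)) := by
  rw [Metric.tendsto_nhds]
  intro ε hε
  have hK : 0 < |K| + 1 := by positivity
  obtain ⟨y, hy, hxy⟩ := hD.exists_dist_lt x (ε := ε / (4 * (|K| + 1))) (by positivity)
  have hxy' : K * ‖x - y‖ ≤ ε / 4 := by
    rw [dist_eq_norm, lt_div_iff₀ (by positivity)] at hxy
    nlinarith [norm_nonneg (x - y), le_abs_self K]
  filter_upwards [(Metric.tendsto_nhds.1 (h y hy)) (ε / 2) (by positivity)] with i hi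
  rw [dist_eq_norm] at hi ⊢
  have e : L i x - S x = L i (x - y) + (L i y - S y) - S (x - y) := by simp
  rw [e]
  have h1 := hL i (x - y)
  have h2 := hS (x - y)
  have h3 := norm_sub_le (L i (x - y) + (L i y - S y)) (S (x - y))
  have h4 := norm_add_le (L i (x - y)) (L i y - S y)
  linarith

variable [CompleteSpace X]

theorem hasDerivAt_exp_smul_apply (B : X →L[ℝ] X) (x : X) (t : ℝ) :
    HasDerivAt (fun s : ℝ => NormedSpace.exp (s • B) x) (B (NormedSpace.exp (t • B) x)) t := by
  have h := hasDerivAt_exp_smul_const' (𝕂 := ℝ) B t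
  have h2 := ((ContinuousLinearMap.apply ℝ X x).hasFDerivAt (x := NormedSpace.exp (t • B))).comp_hasDerivAt t h
  exact h2

/-- If bounded commuting dissipative operators converge strongly to the densely defined operator
`A`, then an extension of `A` generates a contraction semigroup. -/
theorem exists_semigroup_of_tendsto {A : Submodule ℝ (X × X)} {B : ℕ → X →L[ℝ] X}
    (hB : ∀ n, Dissipative (B n).toLinearMap.graph) (hcomm : ∀ m n, Commute (B m) (B n))
    (hAB : ∀ p ∈ A, Tendsto (fun n => B n p.1) atTop (𝓝 p.2))
    (hd : Dense (Prod.fst '' (A : Set (X × X)))) :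
    ∃ T : ℝ≥0 → X →L[ℝ] X, IsC0Semigroup T ∧ (∀ t x, ‖T t x‖ ≤ ‖x‖) ∧
      (A : Set (X × X)) ⊆ generator T := by
  set E : ℕ → ℝ → X →L[ℝ] X := fun n t => NormedSpace.exp (t • B n) with hE
  have hE0 : ∀ n, E n 0 = 1 := fun n => by simp [hE]
  have hder : ∀ n x t, HasDerivAt (fun s => E n s x) (B n (E n t x)) t :=
    fun n x t => hasDerivAt_exp_smul_apply (B n) x t
  have hcont : ∀ n x, Continuous fun s => E n s x :=
    fun n x => continuous_iff_continuousAt.2 fun t => (hder n x t).continuousAt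
  have hcontr : ∀ n t x, 0 ≤ t → ‖E n t x‖ ≤ ‖x‖ := by
    intro n t x ht
    have := (hB n).norm_le (w := fun s => E n s x) (y := fun s => B n (E n s x)) (e := 0) (C := 0)
      ht (hcont n x).continuousOn fun s _ => ⟨by simp [LinearMap.mem_graph_iff], by simpa using hder n x s, by simp⟩
    simpa [hE0] using this
  have hEB : ∀ m n t x, B m (E n t x) = E n t (B m x) := by
    intro m n t x
    have : Commute (B m) (E n t) := ((hcomm m n).smul_right t).exp_right
    exact DFunLike.congr_fun this.eq x
  -- By commutativity, w = E m x - E n x solves w' = B m w + E n (B m x - B n x), and E n is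
  -- contractive.
  have hdiff : ∀ m n t x, 0 ≤ t → ‖E m t x - E n t x‖ ≤ ‖B m x - B n x‖ * t := by
    intro m n t x ht
    have := (hB m).norm_le (w := fun s => E m s x - E n s x)
      (y := fun s => B m (E m s x - E n s x)) (e := fun s => E n s (B m x - B n x))
      (C := ‖B m x - B n x‖) ht ((hcont m x).sub (hcont n x)).continuousOn fun s hs =>
        ⟨by simp [LinearMap.mem_graph_iff], ?_, hcontr _ _ _ hs.1.le⟩
    · simpa [hE0] using this
    · refine ((hder m x s).sub (hder n x s)).congr_deriv ?_
      rw [map_sub, map_sub, ← hEB, ← hEB]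
      abel
  have hlip : ∀ n x s t, 0 ≤ s → s ≤ t → ‖E n t x - E n s x‖ ≤ ‖B n x‖ * (t - s) := by
    intro n x s t hs hst
    refine norm_image_sub_le_of_norm_deriv_le_segment' (f := fun s => E n s x)
      (f' := fun s => B n (E n s x)) (a := s) (b := t) (fun r hr => (hder n x r).hasDerivWithinAt)
      (fun r hr => ?_) t (right_mem_Icc.2 hst)
    rw [hEB]
    exact hcontr _ _ _ (hs.trans hr.1)
  have hcau : ∀ t x, 0 ≤ t → CauchySeq fun n => E n t x := by
    intro t x ht
    rw [Metric.cauchySeq_iff']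
    intro ε hε
    obtain ⟨_, ⟨p, hp, rfl⟩, hxp⟩ := hd.exists_dist_lt x (ε := ε / 4) (by positivity)
    obtain ⟨N, hN⟩ := (Metric.cauchySeq_iff'.1 (hAB p hp).cauchySeq) (ε / (4 * (t + 1)))
      (by positivity)
    refine ⟨N, fun n hn => ?_⟩
    have h1 := hN n hn
    rw [dist_eq_norm] at h1 hxp ⊢
    have h2 := hdiff n N t p.1 ht
    have h3 : ‖B n p.1 - B N p.1‖ * t ≤ ε / 4 := by
      rw [lt_div_iff₀ (by positivity)] at h1
      nlinarith [norm_nonneg (B n p.1 - B N p.1)]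
    have e : E n t x - E N t x = E n t (x - p.1) + (E n t p.1 - E N t p.1) - E N t (x - p.1) := by
      simp
    rw [e]
    have h5 := hcontr n t (x - p.1) ht
    have h6 := hcontr N t (x - p.1) ht
    have h7 := norm_sub_le (E n t (x - p.1) + (E n t p.1 - E N t p.1)) (E N t (x - p.1))
    have h8 := norm_add_le (E n t (x - p.1)) (E n t p.1 - E N t p.1)
    linarith
  have hlim : ∀ t : ℝ≥0, ∃ S : X →L[ℝ] X, ∀ x, Tendsto (fun n => E n t x) atTop (𝓝 (S x)) := by
    intro t
    choose S hS using fun x => cauchySeq_tendsto_of_complete (hcau t x t.2)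
    exact ⟨continuousLinearMapOfTendsto (fun n => E n t) (tendsto_pi_nhds.2 hS), hS⟩
  choose T hT using hlim
  have hTc : ∀ t x, ‖T t x‖ ≤ ‖x‖ := fun t x =>
    le_of_tendsto (hT t x).norm (Eventually.of_forall fun n => hcontr n t x t.2)
  have hTlip : ∀ p ∈ A, LipschitzWith ‖p.2‖₊ fun t => T t p.1 := by
    intro p hp
    refine LipschitzWith.of_dist_le_mul fun t s => ?_
    wlog hst : s ≤ t generalizing s t
    · rw [dist_comm, dist_comm t s]; exact this s t (le_of_not_ge hst)
    rw [dist_eq_norm, NNReal.dist_eq, abs_of_nonneg (sub_nonneg.2 (NNReal.coe_le_coe.2 hst))]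
    exact le_of_tendsto_of_tendsto' ((hT t p.1).sub (hT s p.1)).norm
      ((hAB p hp).norm.mul_const _) fun n => hlip n p.1 s t s.2 (NNReal.coe_le_coe.2 hst)
  have hC0 : IsC0Semigroup T := by
    refine ⟨?_, ?_, ?_⟩
    · ext x
      refine tendsto_nhds_unique (hT 0 x) ?_
      simp [hE0]
    · intro s t
      ext x
      refine tendsto_nhds_unique (hT (s + t) x) ?_
      -- The operator and its argument both vary with n; contractivity of E n s disposes of the
      -- first term.
      have h1 : ∀ n, E n ((s + t : ℝ≥0) : ℝ) x = E n s (E n t x - T t x) + E n s (T t x) := by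
        intro n
        rw [← map_add, sub_add_cancel]
        have : E n ((s + t : ℝ≥0) : ℝ) = E n s * E n t := by
          simp only [hE, NNReal.coe_add, add_smul]
          let _ : NormedAlgebra ℚ (X →L[ℝ] X) := NormedAlgebra.restrictScalars ℚ ℝ _
          exact NormedSpace.exp_add_of_commute (((Commute.refl _).smul_left _).smul_right _)
        rw [this]; rfl
      simp_rw [h1]
      rw [← zero_add ((T s).comp (T t) x)]
      refine Tendsto.add ?_ (hT s (T t x))
      refine squeeze_zero_norm (fun n => hcontr n s _ s.2) ?_
      simpa using ((hT t x).sub_const (T t x)).norm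
    · intro x
      rw [continuous_iff_continuousAt]
      intro t
      refine tendsto_of_dense (L := T) (K := 1) (by simpa using hTc) (by simpa using hTc t) hd ?_ x
      rintro _ ⟨p, hp, rfl⟩
      exact (hTlip p hp).continuous.tendsto t
  refine ⟨T, hC0, hTc, fun p hp => ?_⟩
  have hy := hC0.continuous_orbit_real p.2
  -- The limit of the same formula for the exponentials; differentiating it at 0 identifies the
  -- generator on A.
  have hint : ∀ t : ℝ≥0, T t p.1 - p.1 = ∫ s in (0 : ℝ)..t, T s.toNNReal p.2 := by
    intro t
    have h1 : ∀ n, E n t p.1 - p.1 = ∫ s in (0 : ℝ)..t, E n s (B n p.1) := by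
      intro n
      rw [intervalIntegral.integral_eq_sub_of_hasDerivAt (f := fun s => E n s p.1)
        (fun s _ => by rw [← hEB]; exact hder n p.1 s) ((hcont n _).intervalIntegrable _ _)]
      simp [hE0]
    refine tendsto_nhds_unique ((hT t p.1).sub_const p.1) ?_
    simp_rw [h1]
    obtain ⟨C, hC⟩ := (hAB p hp).norm.bddAbove_range
    refine intervalIntegral.tendsto_integral_filter_of_dominated_convergence (fun _ => C) ?_ ?_ ?_ ?_
    · exact Eventually.of_forall fun n => (hcont n _).aestronglyMeasurable
    · refine Eventually.of_forall fun n => Eventually.of_forall fun s hs => ?_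
      rw [uIoc_of_le t.coe_nonneg] at hs
      exact (hcontr n s _ hs.1.le).trans (hC ⟨n, rfl⟩)
    · exact intervalIntegrable_const
    · refine Eventually.of_forall fun s hs => ?_
      rw [uIoc_of_le t.coe_nonneg] at hs
      have h2 : ∀ n, E n s (B n p.1) = E n s (B n p.1 - p.2) + E n s p.2 := fun n => by simp
      simp_rw [h2]
      rw [← zero_add (T s.toNNReal p.2)]
      refine Tendsto.add ?_ (by simpa [Real.coe_toNNReal _ hs.1.le] using hT s.toNNReal p.2)
      refine squeeze_zero_norm (fun n => hcontr n s _ hs.1.le) ?_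
      simpa using ((hAB p hp).sub_const p.2).norm
  have h0 : HasDerivAt (fun s => ∫ r in (0 : ℝ)..s, T r.toNNReal p.2) (T (0 : ℝ).toNNReal p.2) 0 :=
    intervalIntegral.integral_hasDerivAt_right (hy.intervalIntegrable _ _)
      (hy.stronglyMeasurableAtFilter _ _) hy.continuousAt
  have h1 := hasDerivAt_iff_tendsto_slope.1 h0
  rw [Real.toNNReal_zero, hC0.map_zero] at h1
  have h2 : Tendsto (fun t : ℝ≥0 => (t : ℝ)) (𝓝[>] 0) (𝓝[≠] 0) := by
    refine tendsto_nhdsWithin_iff.2 ⟨?_, ?_⟩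
    · exact (NNReal.continuous_coe.tendsto 0).mono_left nhdsWithin_le_nhds
    · filter_upwards [self_mem_nhdsWithin] with z hz
      exact NNReal.coe_ne_zero.2 (ne_of_gt hz)
  refine (h1.comp h2).congr fun t => ?_
  simp [slope, hint]

/-- The resolvent of a dissipative operator. -/
theorem Dissipative.exists_resolvent {X : Type*} [NormedAddCommGroup X] [NormedSpace ℝ X]
    {A : Submodule ℝ (X × X)} (hA : Dissipative A)
    {l : ℝ} (hl : 0 < l) (hs : ∀ k, ∃ p ∈ A, l • p.1 - p.2 = k) :
    ∃ R : X →L[ℝ] X, (∀ k, (R k, l • R k - k) ∈ A) ∧ (∀ p ∈ A, R (l • p.1 - p.2) = p.1) ∧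
      ∀ k, ‖l • R k‖ ≤ ‖k‖ := by
  choose p hp hpk using hs
  have hmem : ∀ k, ((p k).1, l • (p k).1 - k) ∈ A := fun k => by
    have : l • (p k).1 - k = (p k).2 := by
      rw [sub_eq_iff_eq_add, ← sub_eq_iff_eq_add', hpk k]
    rw [this]; exact hp k
  have huniq : ∀ k, ∀ q ∈ A, l • q.1 - q.2 = k → (p k).1 = q.1 := fun k q hq hqk =>
    congrArg Prod.fst (hA.eq_of_solves hl (hp k) hq ((hpk k).trans hqk.symm))
  have hnorm : ∀ k, ‖l • (p k).1‖ ≤ ‖k‖ := by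
    intro k
    have h1 := hA _ (hp k) l⁻¹ (inv_nonneg.2 hl.le)
    have h2 : l • ((p k).1 - l⁻¹ • (p k).2) = k := by
      rw [smul_sub, smul_smul, mul_inv_cancel₀ hl.ne', one_smul, hpk]
    calc ‖l • (p k).1‖ ≤ ‖l • ((p k).1 - l⁻¹ • (p k).2)‖ := by
          rw [norm_smul, norm_smul]; gcongr
      _ = ‖k‖ := by rw [h2]
  let L : X →ₗ[ℝ] X :=
    { toFun := fun k => (p k).1
      map_add' := fun k m => huniq _ _ (A.add_mem (hp k) (hp m)) (by
        conv_rhs => rw [← hpk k, ← hpk m]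
        simp only [Prod.fst_add, Prod.snd_add, smul_add]; abel)
      map_smul' := fun c k => huniq _ _ (A.smul_mem c (hp k)) (by
        conv_rhs => rw [← hpk k]
        simp only [Prod.smul_fst, Prod.smul_snd]; module) }
  refine ⟨L.mkContinuous l⁻¹ fun k => ?_, hmem, fun q hq => huniq _ q hq rfl, hnorm⟩
  have := hnorm k
  rw [norm_smul, Real.norm_eq_abs, abs_of_pos hl] at this
  rw [inv_mul_eq_div, le_div_iff₀ hl, mul_comm]
  exact this

/-- A dissipative operator whose domain is dense and for which `l - A` is onto for all `l > 0`
generates a contraction semigroup. -/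
theorem Dissipative.exists_generates {A : Submodule ℝ (X × X)} (hA : Dissipative A)
    (hs : ∀ l : ℝ, 0 < l → ∀ k, ∃ p ∈ A, l • p.1 - p.2 = k)
    (hd : Dense (Prod.fst '' (A : Set (X × X)))) :
    ∃ T : ℝ≥0 → X →L[ℝ] X, Generates (A : Set (X × X)) T ∧ ∀ t x, ‖T t x‖ ≤ ‖x‖ := by
  have hl : ∀ n : ℕ, (0 : ℝ) < n + 1 := fun n => by positivity
  choose R hR hRA hRn using fun n : ℕ => hA.exists_resolvent (hl n) (hs _ (hl n))
  -- The resolvent identity, with R n the resolvent at n + 1 so that n = 0 is allowed.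
  have hRR : ∀ (m n : ℕ) (k : X), ((m + 1 : ℝ) - (n + 1)) • R m (R n k) = R n k - R m k := by
    intro m n k
    have h1 := hRA m _ (hR n k)
    rw [eq_sub_iff_add_eq, ← map_smul, ← map_add]
    refine Eq.trans ?_ h1
    congr 1
    module
  have hcomm : ∀ m n, Commute (R m) (R n) := by
    intro m n
    rcases eq_or_ne m n with rfl | hmn
    · exact Commute.refl _
    ext k
    have hne : ((m + 1 : ℝ) - (n + 1)) ≠ 0 := by
      simpa [sub_eq_zero] using hmn
    refine smul_right_injective X hne ?_
    have h1 := hRR m n k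
    have h2 := hRR n m k
    calc ((m + 1 : ℝ) - (n + 1)) • R m (R n k) = R n k - R m k := h1
      _ = -(((n + 1 : ℝ) - (m + 1)) • R n (R m k)) := by rw [h2]; abel
      _ = ((m + 1 : ℝ) - (n + 1)) • R n (R m k) := by module
  -- On the domain, l R x = x + R (A x) with ‖R‖ ≤ 1 / l; density and ‖l R‖ ≤ 1 do the rest.
  have hRlim : ∀ y, Tendsto (fun n : ℕ => ((n + 1 : ℝ) • R n) y) atTop (𝓝 (ContinuousLinearMap.id ℝ X y)) := by
    refine tendsto_of_dense (K := 1) (by simpa using hRn) (by simp) hd ?_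
    rintro _ ⟨p, hp, rfl⟩
    have h1 : ∀ n : ℕ, ((n + 1 : ℝ) • R n) p.1 = p.1 + R n p.2 := by
      intro n
      have := hRA n p hp
      rw [map_sub, map_smul, sub_eq_iff_eq_add] at this
      exact this
    simp_rw [h1]
    have h2 : Tendsto (fun n : ℕ => ‖p.2‖ * (1 / ((n : ℝ) + 1))) atTop (𝓝 0) := by
      simpa using tendsto_one_div_add_atTop_nhds_zero_nat.const_mul ‖p.2‖
    have h3 : Tendsto (fun n => R n p.2) atTop (𝓝 0) := by
      refine squeeze_zero_norm (fun n => ?_) h2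
      have := hRn n p.2
      rw [norm_smul, Real.norm_eq_abs, abs_of_pos (hl n)] at this
      rw [mul_one_div, le_div_iff₀ (hl n), mul_comm]
      exact this
    simpa using h3.const_add p.1
  -- Yosida approximations l² R - l, which equal (l R) A on the domain of A.
  have hgen := exists_semigroup_of_tendsto (A := A)
    (B := fun n : ℕ => ((n + 1 : ℝ) ^ 2) • R n - (n + 1 : ℝ) • 1)
  obtain ⟨T, hT, hTc, hAT⟩ : ∃ T : ℝ≥0 → X →L[ℝ] X, IsC0Semigroup T ∧ (∀ t x, ‖T t x‖ ≤ ‖x‖) ∧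
      (A : Set (X × X)) ⊆ generator T := by
    refine hgen ?_ ?_ ?_ hd
    · rintro n ⟨x, y⟩ hxy h hh
      rw [LinearMap.mem_graph_iff] at hxy
      simp only at hxy
      subst hxy
      have h1 : x - h • (((n + 1 : ℝ) ^ 2) • R n - (n + 1 : ℝ) • (1 : X →L[ℝ] X)) x =
          (1 + h * (n + 1)) • x - (h * (n + 1)) • ((n + 1 : ℝ) • R n x) := by
        simp only [sub_apply, smul_apply,
          one_apply_eq_self]
        module
      change ‖x‖ ≤ ‖x - h • (((n + 1 : ℝ) ^ 2) • R n - (n + 1 : ℝ) • (1 : X →L[ℝ] X)) x‖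
      rw [h1]
      refine le_trans ?_ (norm_sub_norm_le _ _)
      rw [norm_smul, norm_smul _ ((n + 1 : ℝ) • R n x), Real.norm_eq_abs, Real.norm_eq_abs,
        abs_of_nonneg (by positivity), abs_of_nonneg (by positivity)]
      have := mul_le_mul_of_nonneg_left (hRn n x) (mul_nonneg hh (hl n).le)
      linarith
    · intro m n
      have h1 : Commute (((m + 1 : ℝ) ^ 2) • R m) (((n + 1 : ℝ) ^ 2) • R n) :=
        ((hcomm m n).smul_left _).smul_right _
      have h2 : ∀ (c : ℝ) (S : X →L[ℝ] X), Commute S (c • 1) := fun c S =>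
        (Commute.one_right S).smul_right c
      exact (h1.sub_right (h2 _ _)).sub_left ((h2 _ _).symm.sub_right (h2 _ _))
    · intro p hp
      refine (hRlim p.2).congr fun n => ?_
      have := hRA n p hp
      rw [map_sub, map_smul, sub_eq_iff_eq_add] at this
      simp only [sub_apply, smul_apply,
          one_apply_eq_self, pow_two, mul_smul]
      rw [this, smul_add]
      abel
  refine ⟨T, ⟨hT, Subset.antisymm ?_ hAT⟩, hTc⟩
  -- The generator is no larger than A: since 1 - A is onto, an element outside A would give d = x -
  -- p.1 with generator value d. Then ‖T t d‖ would grow like (1 + t)‖d‖ near t = 0, so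
  -- contractivity forces d = 0.
  rintro ⟨x, y⟩ hxy
  obtain ⟨p, hp, hpk⟩ := hs 1 one_pos (x - y)
  have hp' := hAT hp
  have hq : (x - p.1, x - p.1) ∈ generator T := by
    have h1 : Tendsto _ _ _ := Tendsto.sub hxy hp'
    have h2 : y - p.2 = x - p.1 := by
      rw [one_smul] at hpk
      rw [sub_eq_sub_iff_add_eq_add] at hpk ⊢
      rw [add_comm y, hpk]
    simp only [h2] at h1
    refine h1.congr fun t => ?_
    simp only [map_sub]
    module
  have hx : x - p.1 = 0 := by
    have h1 : Tendsto (fun t : ℝ≥0 => ‖(t : ℝ)⁻¹ • (T t (x - p.1) - (x - p.1)) + (t : ℝ)⁻¹ • (x - p.1)‖ - (t : ℝ)⁻¹ * ‖x - p.1‖) (𝓝[>] 0) (𝓝 ‖x - p.1‖) := by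
      have h2 : Tendsto (fun t : ℝ≥0 => ‖(t : ℝ)⁻¹ • (T t (x - p.1) - (x - p.1)) + (t : ℝ)⁻¹ • (x - p.1)‖ - ‖(x - p.1) + (t : ℝ)⁻¹ • (x - p.1)‖) (𝓝[>] 0) (𝓝 0) := by
        have h3 : Tendsto (fun t : ℝ≥0 => ‖(t : ℝ)⁻¹ • (T t (x - p.1) - (x - p.1)) - (x - p.1)‖) (𝓝[>] 0) (𝓝 0) := by
          simpa using (Tendsto.sub_const hq (x - p.1)).norm
        refine squeeze_zero_norm (fun t => ?_) h3
        refine (abs_norm_sub_norm_le _ _).trans (le_of_eq ?_)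
        congr 1
        abel
      rw [← zero_add ‖x - p.1‖]
      refine (h2.add_const _).congr fun t => ?_
      have : ‖(x - p.1) + (t : ℝ)⁻¹ • (x - p.1)‖ = ‖x - p.1‖ + (t : ℝ)⁻¹ * ‖x - p.1‖ := by
        have : (x - p.1) + (t : ℝ)⁻¹ • (x - p.1) = (1 + (t : ℝ)⁻¹) • (x - p.1) := by module
        rw [this, norm_smul, Real.norm_eq_abs, abs_of_nonneg (by positivity)]
        ring
      rw [this]; ring
    have h4 : ‖x - p.1‖ ≤ 0 := by
      refine le_of_tendsto h1 (Eventually.of_forall fun t => ?_)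
      have : (t : ℝ)⁻¹ • (T t (x - p.1) - (x - p.1)) + (t : ℝ)⁻¹ • (x - p.1) =
          (t : ℝ)⁻¹ • T t (x - p.1) := by module
      rw [this, norm_smul, Real.norm_eq_abs, abs_of_nonneg (by positivity), sub_nonpos]
      exact mul_le_mul_of_nonneg_left (hTc t _) (by positivity)
    exact norm_le_zero_iff.1 h4
  rw [sub_eq_zero] at hx
  have hy : y = p.2 := by rw [one_smul, hx, sub_right_inj] at hpk; exact hpk.symm
  rw [hx, hy]
  exact hp

end Generation

/-! ### Solutions of abstract Cauchy problems -/

section Solutions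

variable {X Y : Type*} [NormedAddCommGroup X] [NormedSpace ℝ X]
  [NormedAddCommGroup Y] [NormedSpace ℝ Y]

theorem IsSolution.eq_of_dissipative {A : Submodule ℝ (X × X)} (hA : Dissipative A) {f : X}
    {u v : ℝ≥0 → X} (hu : IsSolution (A : Set (X × X)) f u)
    (hv : IsSolution (A : Set (X × X)) f v) : u = v := by
  have hex : ∀ w : ℝ≥0 → X, IsSolution (A : Set (X × X)) f w → ∃ y : ℝ → X, ∀ t, 0 < t →
      (w t.toNNReal, y t) ∈ A ∧ HasDerivAt (fun s : ℝ => w s.toNNReal) (y t) t := by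
    intro w hw
    have h : ∀ t : ℝ, ∃ y : X, 0 < t →
        (w t.toNNReal, y) ∈ A ∧ HasDerivAt (fun s : ℝ => w s.toNNReal) y t := by
      intro t
      by_cases ht : 0 < t
      · obtain ⟨y, hy⟩ := hw.equation _ (Real.toNNReal_pos.2 ht)
        rw [Real.coe_toNNReal _ ht.le] at hy
        exact ⟨y, fun _ => hy⟩
      · exact ⟨0, fun h => absurd h ht⟩
    choose y hy using h
    exact ⟨y, hy⟩
  obtain ⟨y, hy⟩ := hex u hu
  obtain ⟨z, hz⟩ := hex v hv
  ext t
  have := hA.eq_of_solutions (w₁ := fun s : ℝ => u s.toNNReal) (w₂ := fun s : ℝ => v s.toNNReal)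
    (hu.continuous.comp continuous_real_toNNReal).continuousOn
    (hv.continuous.comp continuous_real_toNNReal).continuousOn
    (by simp [hu.initial, hv.initial]) hy hz t.coe_nonneg
  simpa using this

theorem IsSolution.map {A : Set (X × X)} {B : Set (Y × Y)} (j : X →L[ℝ] Y)
    (hj : ∀ p ∈ A, (j p.1, j p.2) ∈ B) {f : X} {u : ℝ≥0 → X} (hu : IsSolution A f u) :
    IsSolution B (j f) (fun t => j (u t)) where
  continuous := j.continuous.comp hu.continuous
  initial := by rw [hu.initial]
  equation t ht := by
    obtain ⟨v, hv, hd⟩ := hu.equation t ht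
    exact ⟨j v, hj _ hv, j.hasFDerivAt.comp_hasDerivAt (t : ℝ) hd⟩

theorem Generates.isSolution [CompleteSpace X] {A : Set (X × X)} {T : ℝ≥0 → X →L[ℝ] X}
    (hT : Generates A T) {f : X} (hf : ∀ t, 0 < t → ∃ y, (T t f, y) ∈ A) :
    IsSolution A f (fun t => T t f) where
  continuous := hT.1.continuous_orbit f
  initial := by simp [hT.1.map_zero]
  equation t ht := by
    -- The orbit of f at t is the orbit of T (t / 2) f, which lies in the domain, at the positive
    -- time t / 2; there the derivative is two-sided.
    obtain ⟨y, hy⟩ := hf (t / 2) (half_pos ht)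
    rw [← hT.2] at hy ⊢
    have ht2 : (0 : ℝ) < t / 2 := by positivity
    refine ⟨T (t / 2) y, ?_, ?_⟩
    · have := hT.1.generator_orbit hy (t / 2)
      rwa [← ContinuousLinearMap.comp_apply, ← hT.1.map_add, add_halves] at this
    · have h1 := hT.1.hasDerivAt_orbit hy ht2
      have h2 : HasDerivAt (fun s : ℝ => T (s - t / 2).toNNReal (T (t / 2) f))
          (T (t / 2 : ℝ).toNNReal y) (t : ℝ) := by
        refine HasDerivAt.comp_sub_const (f := fun s : ℝ => T s.toNNReal (T (t / 2) f)) (t : ℝ)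
          (t / 2 : ℝ) ?_
        convert h1 using 1
        ring
      have h3 : ((t : ℝ) / 2).toNNReal = t / 2 := by
        rw [Real.toNNReal_div' (by norm_num)]; simp
      rw [h3] at h2
      refine h2.congr_of_eventuallyEq ?_
      filter_upwards [Ioi_mem_nhds (show (t / 2 : ℝ) < t by linarith)] with s hs
      have hs' : (t / 2 : ℝ) < s := hs
      rw [← ContinuousLinearMap.comp_apply, ← hT.1.map_add]
      congr 2
      rw [← h3, ← Real.toNNReal_add (by linarith) ht2.le, sub_add_cancel]

theorem Generates.orbit_mem {A : Set (X × X)} {T : ℝ≥0 → X →L[ℝ] X}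
    (hT : Generates A T) {p : X × X} (hp : p ∈ A) (t : ℝ≥0) : (T t p.1, T t p.2) ∈ A := by
  rw [← hT.2] at hp ⊢
  exact hT.1.generator_orbit hp t

/-- A continuous linear map which maps the graph of one generator into that of another
intertwines the semigroups. -/
theorem Generates.intertwine [CompleteSpace X] [CompleteSpace Y] {A : Set (X × X)}
    {B : Submodule ℝ (Y × Y)} {T : ℝ≥0 → X →L[ℝ] X} {S : ℝ≥0 → Y →L[ℝ] Y}
    (hT : Generates A T) (hS : Generates (B : Set (Y × Y)) S) (hB : Dissipative B)
    (hd : Dense (Prod.fst '' A)) (j : X →L[ℝ] Y) (hj : ∀ p ∈ A, (j p.1, j p.2) ∈ B)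
    (t : ℝ≥0) (x : X) : j (T t x) = S t (j x) := by
  refine hd.induction ?_ (isClosed_eq (j.continuous.comp (T t).continuous)
    ((S t).continuous.comp j.continuous)) x
  rintro _ ⟨p, hp, rfl⟩
  have h1 := (hT.isSolution (f := p.1) fun t _ => ⟨_, hT.orbit_mem hp t⟩).map (B := B) j hj
  have h2 := hS.isSolution (f := j p.1) fun t _ => ⟨_, hS.orbit_mem (hj p hp) t⟩
  exact congrFun (h1.eq_of_dissipative hB h2) t

end Solutions

/-! ### Smoothing for self-adjoint generators -/

section Smoothing

variable {H : Type*} [NormedAddCommGroup H] [InnerProductSpace ℝ H]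

open scoped RealInnerProductSpace

/-- Cauchy-Schwarz applied to ‖x‖² ≤ ⟪x - h y, x⟫. -/
theorem dissipative_of_inner_nonpos {A : Submodule ℝ (H × H)}
    (hA : ∀ p ∈ A, ⟪p.2, p.1⟫ ≤ 0) : Dissipative A := by
  intro p hp h hh
  rcases eq_or_ne p.1 0 with h0 | h0
  · simp [h0]
  have h1 : ‖p.1‖ * ‖p.1‖ ≤ ‖p.1 - h • p.2‖ * ‖p.1‖ := by
    refine le_trans ?_ (real_inner_le_norm _ _)
    rw [inner_sub_left, real_inner_self_eq_norm_mul_norm, inner_smul_left]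
    have := mul_nonpos_of_nonneg_of_nonpos hh (hA p hp)
    simp only [conj_trivial]
    linarith
  exact le_of_mul_le_mul_right h1 (norm_pos_iff.2 h0)

variable [CompleteSpace H]

/-- With u = T x, v = T y = A u and z the value of A at y, set ψ(s) = s²‖v‖² - s⟪v, u⟫ + ‖u‖² / 2.
Symmetry gives ⟪T z, u⟫ = ‖v‖², which collapses ψ' to 2 s²⟪T z, v⟫ ≤ 0. Every term of ψ(t) is
nonnegative and ψ(0) = ‖x‖² / 2. -/
theorem Generates.smoothing_bound {A : Submodule ℝ (H × H)}
    (hneg : ∀ p ∈ A, ⟪p.2, p.1⟫ ≤ 0) (hsymm : ∀ p ∈ A, ∀ q ∈ A, ⟪p.2, q.1⟫ = ⟪p.1, q.2⟫)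
    {T : ℝ≥0 → H →L[ℝ] H} (hT : Generates (A : Set (H × H)) T) {x y z : H} (hxy : (x, y) ∈ A)
    (hyz : (y, z) ∈ A) (t : ℝ≥0) : t * ‖T t y‖ ≤ ‖x‖ := by
  have hxg : (x, y) ∈ generator T := by rw [hT.2]; exact hxy
  have hyg : (y, z) ∈ generator T := by rw [hT.2]; exact hyz
  have hdu : ∀ s : ℝ, 0 < s → HasDerivAt (fun s : ℝ => T s.toNNReal x) (T s.toNNReal y) s :=
    fun s hs => hT.1.hasDerivAt_orbit hxg hs
  have hdv : ∀ s : ℝ, 0 < s → HasDerivAt (fun s : ℝ => T s.toNNReal y) (T s.toNNReal z) s :=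
    fun s hs => hT.1.hasDerivAt_orbit hyg hs
  set ψ : ℝ → ℝ := fun s => s ^ 2 * ⟪T s.toNNReal y, T s.toNNReal y⟫ -
    s * ⟪T s.toNNReal y, T s.toNNReal x⟫ + 2⁻¹ * ⟪T s.toNNReal x, T s.toNNReal x⟫ with hψ
  have hcu := hT.1.continuous_orbit_real x
  have hcv := hT.1.continuous_orbit_real y
  have hanti : AntitoneOn ψ (Ici 0) := by
    have hder : ∀ s : ℝ, 0 < s → HasDerivAt ψ (2 * s ^ 2 * ⟪T s.toNNReal z, T s.toNNReal y⟫) s := by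
      intro s hs
      have hu := hdu s hs
      have hv := hdv s hs
      have h1 := (((hasDerivAt_pow 2 s).mul (hv.inner ℝ hv)).sub
        ((hasDerivAt_id s).mul (hv.inner ℝ hu))).add ((hu.inner ℝ hu).const_mul (2⁻¹ : ℝ))
      refine h1.congr_deriv ?_
      have e1 : ⟪T s.toNNReal z, T s.toNNReal x⟫ = ⟪T s.toNNReal y, T s.toNNReal y⟫ :=
        hsymm _ (hT.orbit_mem hyz s.toNNReal) _ (hT.orbit_mem hxy s.toNNReal)
      simp only [real_inner_comm (T s.toNNReal z) (T s.toNNReal y),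
        real_inner_comm (T s.toNNReal x) (T s.toNNReal y), e1, id]
      push_cast
      ring
    refine antitoneOn_of_deriv_nonpos (convex_Ici 0) (Continuous.continuousOn ?_) ?_ ?_
    · exact (((continuous_pow 2).mul (hcv.inner hcv)).sub (continuous_id.mul (hcv.inner hcu))).add
        ((hcu.inner hcu).const_mul _)
    · rw [interior_Ici]
      exact fun s hs => (hder s hs).differentiableAt.differentiableWithinAt
    · rw [interior_Ici]
      intro s hs
      rw [(hder s hs).deriv]
      exact mul_nonpos_of_nonneg_of_nonpos (by positivity)
        (hneg _ (hT.orbit_mem hyz s.toNNReal))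
  have h1 := hanti self_mem_Ici t.coe_nonneg t.coe_nonneg
  have h2 : ⟪T t y, T t x⟫ ≤ 0 := hneg _ (hT.orbit_mem hxy t)
  simp only [hψ, Real.toNNReal_coe, Real.toNNReal_zero, hT.1.map_zero,
    ContinuousLinearMap.coe_id', id, real_inner_self_eq_norm_sq] at h1
  have h3 : (t : ℝ) * ⟪T t y, T t x⟫ ≤ 0 := mul_nonpos_of_nonneg_of_nonpos t.2 h2
  refine abs_le_of_sq_le_sq' (a := (t : ℝ) * ‖T t y‖) ?_ (norm_nonneg _) |>.2
  nlinarith [sq_nonneg ‖T t x‖, sq_nonneg ‖x‖]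

/-- A semigroup with a nonpositive self-adjoint generator maps into the domain. -/
theorem Generates.smoothing {A : Submodule ℝ (H × H)}
    (hneg : ∀ p ∈ A, ⟪p.2, p.1⟫ ≤ 0) (hsymm : ∀ p ∈ A, ∀ q ∈ A, ⟪p.2, q.1⟫ = ⟪p.1, q.2⟫)
    (hs : ∀ k, ∃ p ∈ A, (1 : ℝ) • p.1 - p.2 = k)
    (hd : Dense (Prod.fst '' (A : Set (H × H))))
    {T : ℝ≥0 → H →L[ℝ] H} (hT : Generates (A : Set (H × H)) T) {t : ℝ≥0} (ht : 0 < t) (x : H) :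
    ∃ y, (T t x, y) ∈ A := by
  obtain ⟨R, hR, hRA, -⟩ := (dissipative_of_inner_nonpos hneg).exists_resolvent one_pos hs
  simp only [one_smul] at hR hRA
  have hrange : DenseRange R := by
    refine hd.mono ?_
    rintro _ ⟨p, hp, rfl⟩
    exact ⟨_, hRA p hp⟩
  have hclosed : IsClosed (A : Set (H × H)) := by
    have : (A : Set (H × H)) = {p | R (p.1 - p.2) = p.1} := by
      ext p
      refine ⟨fun hp => hRA p hp, fun hp => ?_⟩
      have := hR (p.1 - p.2)
      rw [show R (p.1 - p.2) = p.1 from hp, sub_sub_cancel] at this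
      exact this
    rw [this]
    exact isClosed_eq (by fun_prop) (by fun_prop)
  -- The bound requires x in the domain of A²; the range of R² supplies a dense set of such x. Along
  -- a sequence there, A T t a is Cauchy, and closedness of A passes to the limit.
  have hrange2 : DenseRange (R ∘ R) := hrange.comp hrange R.continuous
  obtain ⟨a, ha, hax⟩ := mem_closure_iff_seq_limit.1 (hrange2 x)
  choose b hb using ha
  have hmem : ∀ c, (R (R c), R (R c) - R c) ∈ A := fun c => hR (R c)
  have hmem2 : ∀ c, (R (R c) - R c, (R (R c) - R c) - (R c - c)) ∈ A := fun c =>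
    A.sub_mem (hR (R c)) (hR c)
  have hcau : CauchySeq fun k => T t (R (R (b k)) - R (b k)) := by
    have h1 := hax.cauchySeq
    rw [Metric.cauchySeq_iff] at h1 ⊢
    intro ε hε
    obtain ⟨N, hN⟩ := h1 (t * ε) (by positivity)
    refine ⟨N, fun m hm n hn => ?_⟩
    have h2 := hN m hm n hn
    have h3 := hT.smoothing_bound hneg hsymm (hmem (b m - b n)) (hmem2 (b m - b n)) t
    rw [dist_eq_norm, ← hb, ← hb] at h2
    rw [dist_eq_norm]
    simp only [map_sub, Function.comp] at h2 h3 ⊢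
    have e : T t (R (R (b m))) - T t (R (b m)) - (T t (R (R (b n))) - T t (R (b n))) =
      T t (R (R (b m))) - T t (R (R (b n))) - (T t (R (b m)) - T t (R (b n))) := by abel
    rw [e]
    exact lt_of_mul_lt_mul_left (h3.trans_lt h2) t.2
  obtain ⟨y, hy⟩ := cauchySeq_tendsto_of_complete hcau
  refine ⟨y, hclosed.mem_of_tendsto ((((T t).continuous.tendsto x).comp hax).prodMk_nhds hy)
    (Eventually.of_forall fun k => ?_)⟩
  simp only [Function.comp, ← hb]
  exact hT.orbit_mem (hmem (b k)) t

end Smoothing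

/-! ### Differentiable functions on the unit interval -/

/-- `F'` is the derivative of `F` on `[0,1]`, one-sided at the end points. -/
def HasDerivOnI (F F' : C(I, ℝ)) : Prop :=
  ∀ x : I, HasDerivWithinAt (IccExtend zero_le_one F) (F' x) (Icc (0 : ℝ) 1) x

theorem hasDerivOnI_of_hasDerivAt {F F' : C(I, ℝ)} {Φ : ℝ → ℝ} (hF : ∀ x : I, F x = Φ x)
    (h : ∀ x : I, HasDerivAt Φ (F' x) x) : HasDerivOnI F F' := by
  intro x
  refine (h x).hasDerivWithinAt.congr_of_mem (fun y hy => ?_) x.2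
  rw [IccExtend_of_mem _ _ hy, hF]

namespace HasDerivOnI

variable {F F' G G' : C(I, ℝ)}

theorem add (hF : HasDerivOnI F F') (hG : HasDerivOnI G G') : HasDerivOnI (F + G) (F' + G') :=
  fun x => (hF x).add (hG x)

theorem smul (c : ℝ) (hF : HasDerivOnI F F') : HasDerivOnI (c • F) (c • F') :=
  fun x => (hF x).const_mul c

theorem sub (hF : HasDerivOnI F F') (hG : HasDerivOnI G G') : HasDerivOnI (F - G) (F' - G') :=
  fun x => (hF x).sub (hG x)

theorem const (c : ℝ) : HasDerivOnI (ContinuousMap.const I c) 0 :=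
  fun _ => hasDerivWithinAt_const _ _ c

theorem comp {φ φ' : ℝ → ℝ} (hφ : ∀ s, HasDerivAt φ (φ' s) s) (hφc : Continuous φ)
    (hφc' : Continuous φ') (hF : HasDerivOnI F F') :
    HasDerivOnI ((⟨φ, hφc⟩ : C(ℝ, ℝ)).comp F) ((⟨φ', hφc'⟩ : C(ℝ, ℝ)).comp F * F') := by
  intro x
  have h := (hφ (IccExtend zero_le_one F x)).comp_hasDerivWithinAt (x : ℝ) (hF x)
  rw [IccExtend_of_mem _ _ x.2] at h
  exact h

theorem integral_eq (hF : HasDerivOnI F F') (x y : I) (hxy : x ≤ y) :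
    ∫ t in (x : ℝ)..y, IccExtend zero_le_one F' t = F y - F x := by
  have hc : Continuous (IccExtend (zero_le_one (α := ℝ)) F') := F'.continuous.Icc_extend'
  have hcF : Continuous (IccExtend (zero_le_one (α := ℝ)) F) := F.continuous.Icc_extend'
  have hxy' : (x : ℝ) ≤ y := hxy
  rw [intervalIntegral.integral_eq_sub_of_hasDerivAt_of_le hxy'
    (f := IccExtend zero_le_one F) hcF.continuousOn (fun t ht => ?_) (hc.intervalIntegrable _ _)]
  · rw [IccExtend_of_mem _ _ x.2, IccExtend_of_mem _ _ y.2]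
  · have ht' : t ∈ Ioo (0 : ℝ) 1 := ⟨x.2.1.trans_lt ht.1, ht.2.trans_le y.2.2⟩
    rw [IccExtend_of_mem _ _ (Ioo_subset_Icc_self ht')]
    exact (hF ⟨t, Ioo_subset_Icc_self ht'⟩).hasDerivAt (Icc_mem_nhds ht'.1 ht'.2)

end HasDerivOnI

/-- The inclusion of `[0,1]` into `ℝ`. -/
def coordI : C(I, ℝ) := ⟨Subtype.val, continuous_subtype_val⟩

theorem hasDerivOnI_coordI : HasDerivOnI coordI 1 :=
  hasDerivOnI_of_hasDerivAt (Φ := id) (fun _ => rfl) fun _ => hasDerivAt_id _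

/-! ### Potentials of densities -/

section Potential

variable {m : Measure I} [NullSingletonClass m] {g : I → ℝ}

/-- Without atoms, the indicator of {y ≤ x} is continuous in x at each given point for almost every
y; dominated convergence applies. -/
theorem continuous_cumulative (hg : Integrable g m) :
    Continuous fun x : I => ∫ y in Iic x, g y ∂m := by
  simp_rw [← integral_indicator measurableSet_Iic]
  rw [continuous_iff_continuousAt]
  intro x
  refine continuousAt_of_dominated (bound := fun y => ‖g y‖) ?_ ?_ hg.norm ?_
  · exact Eventually.of_forall fun z => hg.aestronglyMeasurable.indicator measurableSet_Iic
  · exact Eventually.of_forall fun z => Eventually.of_forall fun y => norm_indicator_le_norm_self _ _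
  · have hne : ∀ᵐ y ∂m, y ≠ x := by simp [ae_iff]
    filter_upwards [hne] with y hy
    rcases lt_or_gt_of_ne hy with h | h
    · refine (continuousAt_const (y := g y)).congr ?_
      filter_upwards [Ioi_mem_nhds h] with z hz
      rw [indicator_of_mem (mem_Iic.2 (le_of_lt hz))]
    · refine (continuousAt_const (y := (0 : ℝ))).congr ?_
      filter_upwards [Iio_mem_nhds h] with z hz
      rw [indicator_of_notMem (by simpa using hz)]

/-- The cumulative function `x ↦ ∫_{[0,x]} g dm`. -/
def cumulative (hg : Integrable g m) : C(I, ℝ) :=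
  ⟨fun x => ∫ y in Iic x, g y ∂m, continuous_cumulative hg⟩

/-- Differentiation under the integral: (s - y)⁺ is 1-Lipschitz in s, and its kink s = y meets s = x
only on a null set. Letting s range over ℝ makes the derivative two-sided even at the end points. -/
theorem hasDerivAt_integral_max (hg : Integrable g m) (x : I) :
    HasDerivAt (fun s : ℝ => ∫ y, max (s - y) 0 * g y ∂m) (∫ y in Iic x, g y ∂m) x := by
  have hmeas : ∀ s : ℝ, AEStronglyMeasurable (fun y : I => max (s - y) 0 * g y) m := fun s => by
    have : Continuous fun y : I => max (s - (y : ℝ)) 0 := by fun_prop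
    exact this.aestronglyMeasurable.mul hg.aestronglyMeasurable
  rw [← integral_indicator measurableSet_Iic]
  refine (hasDerivAt_integral_of_dominated_loc_of_lip (s := univ) (bound := fun y => ‖g y‖)
    (𝕜 := ℝ) (F := fun s y => max (s - (y : ℝ)) 0 * g y) univ_mem
    (Eventually.of_forall hmeas) ?_ ?_ ?_ hg.norm ?_).2
  · refine hg.norm.mono (hmeas _) (Eventually.of_forall fun y => ?_)
    rw [norm_mul, norm_norm]
    refine mul_le_of_le_one_left (norm_nonneg _) ?_
    rw [Real.norm_eq_abs, abs_of_nonneg (le_max_right _ _)]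
    exact max_le (by linarith [x.2.2, y.2.1]) zero_le_one
  · exact hg.aestronglyMeasurable.indicator measurableSet_Iic
  · refine Eventually.of_forall fun y => LipschitzWith.lipschitzOnWith ?_
    refine LipschitzWith.of_dist_le_mul fun s t => ?_
    rw [Real.dist_eq, Real.dist_eq, ← sub_mul, abs_mul, mul_comm]
    simp only [Real.coe_nnabs, Real.norm_eq_abs]
    have h := abs_max_sub_max_le_abs (s - (y : ℝ)) (t - y) 0
    rw [sub_sub_sub_cancel_right] at h
    rw [abs_abs]
    exact mul_le_mul_of_nonneg_left h (abs_nonneg (g y))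
  · have hne : ∀ᵐ y ∂m, y ≠ x := by simp [ae_iff]
    filter_upwards [hne] with y hy
    rcases lt_or_gt_of_ne hy with h | h
    · rw [indicator_of_mem (mem_Iic.2 h.le)]
      have h1 : HasDerivAt (fun s : ℝ => (s - y) * g y) (g y) x := by
        simpa using ((hasDerivAt_id (x : ℝ)).sub_const (y : ℝ)).mul_const (g y)
      refine h1.congr_of_eventuallyEq ?_
      have h' : (y : ℝ) < x := h
      filter_upwards [Ioi_mem_nhds h'] with s hs
      rw [max_eq_left (sub_nonneg.2 (le_of_lt hs))]
    · rw [indicator_of_notMem (by simpa using h)]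
      refine (hasDerivAt_const (x : ℝ) (0 : ℝ)).congr_of_eventuallyEq ?_
      have h' : (x : ℝ) < y := h
      filter_upwards [Iio_mem_nhds h'] with s hs
      rw [max_eq_right (sub_nonpos.2 (le_of_lt hs)), zero_mul]

/-- The potential `x ↦ ∫ (x - y)⁺ g(y) dm(y)`. -/
def potential (hg : Integrable g m) : C(I, ℝ) :=
  ⟨fun x => ∫ y, max ((x : ℝ) - y) 0 * g y ∂m, continuous_iff_continuousAt.2 fun x =>
    ContinuousAt.comp (f := Subtype.val) (g := fun s : ℝ => ∫ y, max (s - y) 0 * g y ∂m)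
      (hasDerivAt_integral_max hg x).continuousAt continuousAt_subtype_val⟩

theorem hasDerivOnI_potential (hg : Integrable g m) :
    HasDerivOnI (potential hg) (cumulative hg) :=
  hasDerivOnI_of_hasDerivAt (Φ := fun s : ℝ => ∫ y, max (s - y) 0 * g y ∂m) (fun _ => rfl)
    fun x => hasDerivAt_integral_max hg x

theorem cumulative_zero (hg : Integrable g m) : cumulative hg 0 = 0 := by
  have : Iic (0 : I) = {0} := by
    ext x
    rw [mem_Iic, mem_singleton_iff, le_antisymm_iff, and_iff_left (show 0 ≤ x from x.2.1)]
  change ∫ y in Iic 0, g y ∂m = 0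
  rw [this, setIntegral_measure_zero]
  exact measure_singleton 0

theorem cumulative_one (hg : Integrable g m) : cumulative hg 1 = ∫ y, g y ∂m := by
  have : Iic (1 : I) = univ := by ext x; simp [unitInterval.le_one']
  change ∫ y in Iic 1, g y ∂m = _
  rw [this, Measure.restrict_univ]

theorem potential_zero (hg : Integrable g m) : potential hg 0 = 0 := by
  change ∫ y : I, max (((0 : I) : ℝ) - y) 0 * g y ∂m = 0
  rw [integral_eq_zero_of_ae]
  refine Eventually.of_forall fun y => ?_
  have : max (((0 : I) : ℝ) - y) 0 = 0 := max_eq_right (by simpa using y.2.1)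
  simp only [this, zero_mul, Pi.zero_apply]

/-- Integration by parts. -/
theorem integral_mul_eq (hg : Integrable g m) [IsFiniteMeasure m] {G H H' : C(I, ℝ)}
    (hG : ∀ x, G x = G 0 + ∫ y in Iic x, g y ∂m) (hH : HasDerivOnI H H') :
    ∫ y, g y * H y ∂m = H 1 * G 1 - H 0 * G 0 -
      ∫ t in Ioc (0 : ℝ) 1, IccExtend zero_le_one H' t * IccExtend zero_le_one G t := by
  set h' : ℝ → ℝ := IccExtend zero_le_one H' with hh'
  set G' : ℝ → ℝ := IccExtend zero_le_one G with hG'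
  have hc : Continuous h' := H'.continuous.Icc_extend'
  have hcG : Continuous G' := G.continuous.Icc_extend'
  have hIoc : ∀ f : ℝ → ℝ, Continuous f → Integrable f (volume.restrict (Ioc (0 : ℝ) 1)) := fun f hf =>
    (hf.integrableOn_Icc (a := 0) (b := 1)).mono_set Ioc_subset_Icc_self
  -- H is written through its derivative on (y, 1], so that Fubini exchanges t with y.
  have h1 : ∀ y : I, H y = H 1 - ∫ t in Ioc (0 : ℝ) 1, (Ioi (y : ℝ)).indicator h' t := by
    intro y
    rw [setIntegral_indicator measurableSet_Ioi, Ioc_inter_Ioi, max_eq_right y.2.1,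
      ← intervalIntegral.integral_of_le y.2.2]
    have := hH.integral_eq y 1 y.2.2
    rw [show ((1 : I) : ℝ) = 1 from rfl] at this
    rw [this]; ring
  have hcst : ∫ t in Ioc (0 : ℝ) 1, h' t = H 1 - H 0 := by
    rw [← intervalIntegral.integral_of_le zero_le_one]
    exact hH.integral_eq 0 1 zero_le_one
  have htot : ∫ y, g y ∂m = G 1 - G 0 := by
    rw [hG 1, ← cumulative_one hg]
    change _ = G 0 + cumulative hg 1 - G 0
    ring
  obtain ⟨C, hC⟩ : ∃ C, ∀ t, ‖h' t‖ ≤ C := ⟨‖H'‖, fun t => H'.norm_coe_le_norm _⟩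
  have hprod : Integrable (fun z : I × ℝ => g z.1 * (Ioi (z.1 : ℝ)).indicator h' z.2)
      (m.prod (volume.restrict (Ioc (0 : ℝ) 1))) := by
    have hm : Measurable fun z : I × ℝ => (Ioi (z.1 : ℝ)).indicator h' z.2 := by
      have : (fun z : I × ℝ => (Ioi (z.1 : ℝ)).indicator h' z.2) =
          {z : I × ℝ | (z.1 : ℝ) < z.2}.indicator fun z => h' z.2 := by
        ext z; simp [indicator]
      rw [this]
      exact (hc.measurable.comp measurable_snd).indicator
        (measurableSet_lt measurable_fst.subtype_val measurable_snd)
    have h2 : Integrable (fun z : I × ℝ => g z.1) (m.prod (volume.restrict (Ioc (0 : ℝ) 1))) :=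
      hg.comp_fst _
    refine (h2.mul_const C).mono (h2.aestronglyMeasurable.mul hm.aestronglyMeasurable)
      (Eventually.of_forall fun z => ?_)
    rw [norm_mul, norm_mul]
    gcongr
    exact (norm_indicator_le_norm_self _ _).trans ((hC _).trans (le_abs_self C))
  have hswap := integral_integral_swap (f := fun (y : I) (t : ℝ) => g y * (Ioi (y : ℝ)).indicator h' t) hprod
  have hinner : ∀ t ∈ Ioc (0 : ℝ) 1, ∫ y, g y * (Ioi (y : ℝ)).indicator h' t ∂m =
      h' t * G' t - h' t * G 0 := by
    intro t ht
    set x : I := ⟨t, ht.1.le, ht.2⟩ with hx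
    have e1 : ∀ y : I, g y * (Ioi (y : ℝ)).indicator h' t = h' t * (Iio x).indicator g y := by
      intro y
      by_cases h : (y : ℝ) < t
      · have h' : y ∈ Iio x := h
        simp [h, h', mul_comm]
      · have h' : y ∉ Iio x := h
        rw [indicator_of_notMem h', indicator_of_notMem (by simpa using h)]; simp
    simp_rw [e1]
    rw [integral_const_mul, integral_indicator measurableSet_Iio, ← integral_Iic_eq_integral_Iio]
    have e2 : G' t = G x := IccExtend_of_mem _ _ ⟨ht.1.le, ht.2⟩
    rw [e2, hG x]; ring
  have hgH : ∫ y, g y * H y ∂m = H 1 * (G 1 - G 0) -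
      ∫ y, (∫ t in Ioc (0 : ℝ) 1, g y * (Ioi (y : ℝ)).indicator h' t) ∂m := by
    rw [← htot, ← integral_const_mul, ← integral_sub (hg.const_mul _) hprod.integral_prod_left]
    refine integral_congr_ae (Eventually.of_forall fun y => ?_)
    simp only
    rw [integral_const_mul, h1 y]; ring
  rw [hgH, hswap, setIntegral_congr_fun measurableSet_Ioc hinner,
    integral_sub (f := fun t => h' t * G' t) (g := fun t => h' t * G 0) (hIoc _ (hc.mul hcG))
      (hIoc _ (hc.mul continuous_const)),
    integral_mul_const, hcst]
  ring

end Potential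

/-! ### Dissipativity and symmetry of the Krein-Feller operator -/

section Operator

open scoped RealInnerProductSpace

variable {μ : MassDistribution} {b : BoundaryCondition}

instance : NullSingletonClass μ.meas := ⟨μ.measure_singleton⟩

theorem MassDistribution.integrable (g : μ.L2) : Integrable g μ.meas :=
  (Lp.memLp g).integrable one_le_two

theorem MassDistribution.integrable_cont (F : C(I, ℝ)) : Integrable F μ.meas :=
  F.continuous.integrable_of_hasCompactSupport (HasCompactSupport.of_compactSpace _)

theorem MassDistribution.inner_eq (g h : μ.L2) {G H : I → ℝ} (hG : G =ᵐ[μ.meas] g)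
    (hH : H =ᵐ[μ.meas] h) : ⟪g, h⟫ = ∫ y, G y * H y ∂μ.meas := by
  rw [L2.inner_def]
  refine integral_congr_ae ?_
  filter_upwards [hG, hH] with y h1 h2
  rw [h1, h2]
  exact mul_comm _ _

theorem BoundaryCondition.OnDomain.onContinuous {F F' : C(I, ℝ)} (h : b.OnDomain F F') :
    b.OnContinuous F := by
  cases b
  · trivial
  · exact h

/-- The graph of the Krein-Feller operator as a submodule. -/
def kreinFellerSubmodule (μ : MassDistribution) (b : BoundaryCondition) :
    Submodule ℝ (μ.L2 × μ.L2) where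
  carrier := kreinFeller μ b
  zero_mem' := by
    refine ⟨0, 0, (Lp.coeFn_zero ℝ 2 μ.meas).symm, HasDerivOnI.const 0, fun x => ?_, ?_⟩
    · have : ∫ y in Iic x, (0 : μ.L2) y ∂μ.meas = 0 :=
        integral_eq_zero_of_ae (ae_restrict_of_ae (Lp.coeFn_zero ℝ 2 μ.meas))
      rw [Prod.snd_zero, this]; simp
    · cases b <;> simp [BoundaryCondition.OnDomain]
  add_mem' := by
    rintro p q ⟨F, F', hF, hd, hF', hb⟩ ⟨G, G', hG, hd2, hG', hb2⟩
    refine ⟨F + G, F' + G', ?_, HasDerivOnI.add hd hd2, fun x => ?_, ?_⟩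
    · filter_upwards [hF, hG, Lp.coeFn_add p.1 q.1] with y h1 h2 h3
      rw [Prod.fst_add, h3]; simp [h1, h2]
    · have : ∫ y in Iic x, (p + q).2 y ∂μ.meas =
          ∫ y in Iic x, (p.2 y + q.2 y) ∂μ.meas :=
        integral_congr_ae (ae_restrict_of_ae (Lp.coeFn_add p.2 q.2))
      rw [this, integral_add (μ.integrable p.2).integrableOn (μ.integrable q.2).integrableOn]
      simp only [ContinuousMap.add_apply, hF' x, hG' x]; ring
    · cases b <;> exact ⟨by simp [hb.1, hb2.1], by simp [hb.2, hb2.2]⟩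
  smul_mem' := by
    rintro c p ⟨F, F', hF, hd, hF', hb⟩
    refine ⟨c • F, c • F', ?_, HasDerivOnI.smul c hd, fun x => ?_, ?_⟩
    · filter_upwards [hF, Lp.coeFn_smul c p.1] with y h1 h3
      rw [Prod.smul_fst, h3]; simp [h1]
    · have : ∫ y in Iic x, (c • p).2 y ∂μ.meas = ∫ y in Iic x, c • p.2 y ∂μ.meas :=
        integral_congr_ae (ae_restrict_of_ae (Lp.coeFn_smul c p.2))
      rw [this, integral_smul]
      simp only [ContinuousMap.smul_apply, hF' x, smul_eq_mul]; ring
    · cases b <;> exact ⟨by simp [hb.1], by simp [hb.2]⟩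

/-- The boundary terms H F' vanish through F' in the Neumann case and through H in the Dirichlet
case, so H needs only the condition on continuous functions. -/
theorem kreinFeller_weak_form {p : μ.L2 × μ.L2} {F F' H H' : C(I, ℝ)}
    (hF' : ∀ x : I, F' x = F' 0 + ∫ y in Iic x, p.2 y ∂μ.meas) (hb : b.OnDomain F F')
    (hH : HasDerivOnI H H') (hHb : b.OnContinuous H) :
    ∫ y, p.2 y * H y ∂μ.meas =
      -∫ t in Ioc (0 : ℝ) 1, IccExtend zero_le_one H' t * IccExtend zero_le_one F' t := by
  rw [integral_mul_eq (μ.integrable p.2) hF' hH]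
  cases b
  · rw [hb.1, hb.2]; ring
  · rw [hHb.1, hHb.2]; ring

theorem kreinFeller_inner_nonpos : ∀ p ∈ kreinFellerSubmodule μ b, ⟪p.2, p.1⟫ ≤ 0 := by
  rintro p ⟨F, F', hF, hd, hF', hb⟩
  rw [μ.inner_eq p.2 p.1 EventuallyEq.rfl hF,
    kreinFeller_weak_form hF' hb hd hb.onContinuous, neg_nonpos]
  exact integral_nonneg fun t => mul_self_nonneg _

theorem kreinFeller_symm : ∀ p ∈ kreinFellerSubmodule μ b, ∀ q ∈ kreinFellerSubmodule μ b,
    ⟪p.2, q.1⟫ = ⟪p.1, q.2⟫ := by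
  rintro p ⟨F, F', hF, hd, hF', hb⟩ q ⟨G, G', hG, hd2, hG', hb2⟩
  rw [real_inner_comm q.2 p.1, μ.inner_eq q.2 p.1 EventuallyEq.rfl hF, μ.inner_eq p.2 q.1 EventuallyEq.rfl hG,
    kreinFeller_weak_form hF' hb hd2 hb2.onContinuous,
    kreinFeller_weak_form hG' hb2 hd hb.onContinuous]
  simp_rw [mul_comm]

theorem kreinFeller_dissipative : Dissipative (kreinFellerSubmodule μ b) :=
  dissipative_of_inner_nonpos kreinFeller_inner_nonpos

/-! ### The maximum principle and the uniform norm. -/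

theorem hasDerivAt_max_sq (K s : ℝ) :
    HasDerivAt (fun s => max (s - K) 0 ^ 2) (2 * max (s - K) 0) s := by
  rcases lt_trichotomy s K with h | rfl | h
  · rw [max_eq_right (by linarith), mul_zero]
    refine (hasDerivAt_const s (0 : ℝ)).congr_of_eventuallyEq ?_
    filter_upwards [Iio_mem_nhds h] with t ht
    rw [max_eq_right (sub_nonpos.2 (le_of_lt ht))]; simp
  · rw [sub_self, max_self, mul_zero, hasDerivAt_iff_isLittleO]
    have h1 : (fun t => (t - s) ^ 2) =o[𝓝 s] fun t => t - s := by
      have := (Asymptotics.isLittleO_pow_id (one_lt_two)).comp_tendsto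
        (show Tendsto (fun t : ℝ => t - s) (𝓝 s) (𝓝 0) by
          have hc : Continuous fun t : ℝ => t - s := by fun_prop
          simpa using hc.tendsto s)
      exact this
    refine (Asymptotics.IsBigO.of_bound 1 (Eventually.of_forall fun t => ?_)).trans_isLittleO h1
    simp only [sub_self, max_self, smul_zero, sub_zero, one_mul, norm_pow, ne_eq,
      OfNat.ofNat_ne_zero, not_false_eq_true, zero_pow, Real.norm_eq_abs, sq_abs]
    rw [← sq_abs (t - s)]
    refine pow_le_pow_left₀ (le_max_right _ _) (max_le (le_abs_self _) (abs_nonneg _)) 2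
  · rw [max_eq_left (by linarith)]
    have h1 : HasDerivAt (fun s => (s - K) ^ 2) (2 * (s - K)) s := by
      simpa [Pi.pow_def] using ((hasDerivAt_id s).sub_const K).pow 2
    refine h1.congr_of_eventuallyEq ?_
    filter_upwards [Ioi_mem_nhds h] with t ht
    rw [max_eq_left (sub_nonneg.2 (le_of_lt ht))]

/-- The weak maximum principle. -/
theorem kreinFeller_max_principle {p : μ.L2 × μ.L2} (hp : p ∈ kreinFellerSubmodule μ b)
    {l K : ℝ} (hl : 0 < l) (hK : 0 ≤ K)
    (h : ∀ᵐ y ∂μ.meas, l * p.1 y - p.2 y ≤ l * K) : ∀ᵐ y ∂μ.meas, p.1 y ≤ K := by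
  obtain ⟨F, F', hF, hd, hF', hb⟩ := hp
  have hφc : Continuous fun s : ℝ => max (s - K) 0 ^ 2 := by fun_prop
  have hφc' : Continuous fun s : ℝ => 2 * max (s - K) 0 := by fun_prop
  have hH := HasDerivOnI.comp (hasDerivAt_max_sq K) hφc hφc' hd
  set H : C(I, ℝ) := (⟨_, hφc⟩ : C(ℝ, ℝ)).comp F with hHdef
  have hHval : ∀ y, H y = max (F y - K) 0 ^ 2 := fun y => rfl
  -- K ≥ 0 makes the test function ((F - K)⁺)² vanish wherever F does, as the Dirichlet condition
  -- demands.
  have hHb : b.OnContinuous H := by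
    have h0 : max (0 - K) 0 = 0 := max_eq_right (by linarith)
    cases b
    · trivial
    · have := hb.onContinuous
      exact ⟨by rw [hHval, this.1, h0]; simp, by rw [hHval, this.2, h0]; simp⟩
  have hw := kreinFeller_weak_form hF' hb hH hHb
  have hle : ∫ y, p.2 y * H y ∂μ.meas ≤ 0 := by
    rw [hw, neg_nonpos]
    refine integral_nonneg fun t => ?_
    change 0 ≤ (2 * max (F (projIcc 0 1 zero_le_one t) - K) 0 * F' (projIcc 0 1 zero_le_one t)) *
      F' (projIcc 0 1 zero_le_one t)
    rw [mul_assoc]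
    exact mul_nonneg (by positivity) (mul_self_nonneg _)
  have hQ : Continuous fun y => l * max (F y - K) 0 ^ 3 := by fun_prop
  have hQi : Integrable (fun y => l * max (F y - K) 0 ^ 3) μ.meas := μ.integrable_cont ⟨_, hQ⟩
  have hgi : Integrable (fun y => p.2 y * H y) μ.meas :=
    (μ.integrable p.2).mul_bdd (c := ‖H‖) H.continuous.aestronglyMeasurable
      (Eventually.of_forall fun y => H.norm_coe_le_norm y)
  -- The hypothesis reads l (F - K) ≤ p.2. The right-hand side is at most 0, being minus the
  -- integral of 2 (F - K)⁺ F'², so (F - K)⁺ = 0 almost everywhere.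
  have hQle : ∫ y, l * max (F y - K) 0 ^ 3 ∂μ.meas ≤ ∫ y, p.2 y * H y ∂μ.meas := by
    refine integral_mono_ae hQi hgi ?_
    filter_upwards [h, hF] with y h1 h2
    rw [hHval]
    have h3 : l * (F y - K) ≤ p.2 y := by rw [← h2] at h1; linarith
    have h4 : l * max (F y - K) 0 ^ 3 = l * (F y - K) * max (F y - K) 0 ^ 2 := by
      rcases le_total (F y - K) 0 with h5 | h5
      · rw [max_eq_right h5]; ring
      · rw [max_eq_left h5]; ring
    rw [h4]
    exact mul_le_mul_of_nonneg_right h3 (by positivity)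
  have hzero := (integral_eq_zero_iff_of_nonneg (fun y => by positivity) hQi).1
    (le_antisymm (hQle.trans hle) (integral_nonneg fun y => by positivity))
  filter_upwards [hzero, hF] with y h1 h2
  rw [← h2]
  by_contra hlt
  have h3 : 0 < F y - K := by linarith
  have : 0 < l * max (F y - K) 0 ^ 3 := by rw [max_eq_left h3.le]; positivity
  exact this.ne' h1

/-! ### The part in the space of continuous functions -/

namespace CSpace

/-- For a continuous function, the supremum over the support is the essential supremum; the norm can
thus be estimated through any representative. -/
theorem norm_le_iff {f : CSpace μ b} {K : ℝ} (hK : 0 ≤ K) {F : I → ℝ}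
    (hF : F =ᵐ[μ.meas] toL2 f) : ‖f‖ ≤ K ↔ ∀ᵐ y ∂μ.meas, |F y| ≤ K := by
  have hn : ‖f‖ = ‖restrictSupp f‖ := rfl
  rw [hn, ContinuousMap.norm_le _ hK]
  constructor
  · intro h
    filter_upwards [hF, rep_ae f, Measure.support_mem_ae (μ := μ.meas)] with y h1 h2 h3
    rw [h1, ← h2]
    exact h ⟨y, h3⟩
  · rintro h ⟨x, hx⟩
    change |f.rep x| ≤ K
    by_contra! hlt
    have hopen : IsOpen {y | K < |f.rep y|} :=
      isOpen_lt continuous_const (f.rep.continuous.abs)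
    have hpos := (Measure.mem_support_iff_forall x).1 hx _ (hopen.mem_nhds hlt)
    refine hpos.ne' (measure_mono_null (t := {y | ¬ |f.rep y| ≤ K}) (fun y hy => not_le.2 hy) ?_)
    refine ae_iff.1 ?_
    filter_upwards [h, hF, rep_ae f] with y h1 h2 h3
    rwa [h3, ← h2]

theorem ae_abs_le_norm (f : CSpace μ b) : ∀ᵐ y ∂μ.meas, |toL2 f y| ≤ ‖f‖ :=
  (norm_le_iff (norm_nonneg f) EventuallyEq.rfl).1 le_rfl

/-- The inclusion of `(C[0,1])_μ^b` into `L²([0,1], μ)` as a continuous linear map. -/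
def toL2L : CSpace μ b →L[ℝ] μ.L2 :=
  toL2.mkContinuous 1 fun f => by
    have := Lp.norm_le_of_ae_bound (p := 2) (f := toL2 f) (norm_nonneg f)
      (by simpa [Real.norm_eq_abs] using ae_abs_le_norm f)
    simpa [measureUnivNNReal] using this

/-- The class of a continuous function satisfying the boundary condition. -/
def ofCont (F : C(I, ℝ)) (hF : b.OnContinuous F) : CSpace μ b :=
  ⟨ContinuousMap.toLp 2 μ.meas ℝ F, F, (ContinuousMap.coeFn_toLp μ.meas F).symm, hF⟩

theorem ofCont_ae (F : C(I, ℝ)) (hF : b.OnContinuous F) :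
    (F : I → ℝ) =ᵐ[μ.meas] toL2 (ofCont F hF : CSpace μ b) :=
  (ContinuousMap.coeFn_toLp μ.meas F).symm

theorem toL2_ofCont (F : C(I, ℝ)) (hF : b.OnContinuous F) :
    toL2 (ofCont F hF : CSpace μ b) = ContinuousMap.toLp 2 μ.meas ℝ F := rfl

theorem ext_toL2 {f g : CSpace μ b} (h : toL2 f = toL2 g) : f = g := Subtype.ext h

end CSpace

/-- The graph of the part of the Krein-Feller operator as a submodule. -/
def kreinFellerBarSubmodule (μ : MassDistribution) (b : BoundaryCondition) :
    Submodule ℝ (CSpace μ b × CSpace μ b) :=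
  (kreinFellerSubmodule μ b).comap (CSpace.toL2.prodMap CSpace.toL2)

/-- The maximum principle with l = 1 / h and K = ‖p.1 - h p.2‖, for p and for -p. -/
theorem kreinFellerBar_dissipative : Dissipative (kreinFellerBarSubmodule μ b) := by
  intro p hp h hh
  rcases hh.eq_or_lt with rfl | hpos
  · simp
  have key : ∀ q ∈ kreinFellerBarSubmodule μ b,
      ∀ᵐ y ∂μ.meas, CSpace.toL2 q.1 y ≤ ‖q.1 - h • q.2‖ := by
    intro q hq
    have h1 := CSpace.ae_abs_le_norm (q.1 - h • q.2)
    refine kreinFeller_max_principle (l := h⁻¹) hq (inv_pos.2 hpos) (norm_nonneg _) ?_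
    rw [map_sub, map_smul] at h1
    filter_upwards [h1, Lp.coeFn_sub (CSpace.toL2 q.1) (h • CSpace.toL2 q.2),
      Lp.coeFn_smul h (CSpace.toL2 q.2)] with y h2 h3 h4
    rw [h3, Pi.sub_apply, h4, Pi.smul_apply, smul_eq_mul] at h2
    have h5 := mul_le_mul_of_nonneg_left (le_of_abs_le h2) (inv_pos.2 hpos).le
    rw [mul_sub, inv_mul_cancel_left₀ hpos.ne'] at h5
    exact h5
  rw [CSpace.norm_le_iff (norm_nonneg _) EventuallyEq.rfl]
  have h2 := key (-p) (neg_mem hp)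
  have h3 : ‖(-p).1 - h • (-p).2‖ = ‖p.1 - h • p.2‖ := by
    rw [← norm_neg]; congr 1; simp only [Prod.fst_neg, Prod.snd_neg]; module
  rw [h3, Prod.fst_neg, map_neg] at h2
  filter_upwards [key p hp, h2, Lp.coeFn_neg (CSpace.toL2 p.1)] with y h4 h5 h6
  rw [h6, Pi.neg_apply] at h5
  exact abs_le.2 ⟨by linarith, h4⟩

end Operator

/-! ### Solvability of the resolvent equation -/

section Resolvent

open scoped RealInnerProductSpace

/-- Lax-Milgram: ⟪u - l S u, u⟫ ≥ ‖u‖². -/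
theorem exists_sub_smul_eq {H : Type*} [NormedAddCommGroup H] [InnerProductSpace ℝ H]
    [CompleteSpace H] {S : H →L[ℝ] H} (hS : ∀ g, ⟪S g, g⟫ ≤ 0) {l : ℝ} (hl : 0 < l) (k : H) :
    ∃ g, g - l • S g = k := by
  set B : H →L[ℝ] H →L[ℝ] ℝ := (innerSL ℝ).comp (ContinuousLinearMap.id ℝ H - l • S) with hB
  have hBval : ∀ u v, B u v = ⟪u - l • S u, v⟫ := fun u v => rfl
  have hco : IsCoercive B := by
    refine ⟨1, one_pos, fun u => ?_⟩
    rw [hBval, inner_sub_left, real_inner_self_eq_norm_mul_norm, inner_smul_left]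
    have := mul_nonpos_of_nonneg_of_nonpos hl.le (hS u)
    simp only [conj_trivial]
    linarith
  refine ⟨hco.continuousLinearEquivOfBilin.symm k, ?_⟩
  refine ext_inner_right ℝ fun v => ?_
  rw [← hBval, ← hco.continuousLinearEquivOfBilin_apply, ContinuousLinearEquiv.apply_symm_apply]

variable {μ : MassDistribution} {b : BoundaryCondition}

theorem norm_toLp_le (μ : MassDistribution) (F : C(I, ℝ)) :
    ‖ContinuousMap.toLp 2 μ.meas ℝ F‖ ≤ ‖F‖ := by
  have := Lp.norm_le_of_ae_bound (p := 2) (f := ContinuousMap.toLp 2 μ.meas ℝ F) (norm_nonneg F) (by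
    filter_upwards [ContinuousMap.coeFn_toLp (p := 2) (𝕜 := ℝ) μ.meas F] with y hy
    rw [hy]; exact F.norm_coe_le_norm y)
  simpa [measureUnivNNReal] using this

/-- The kernel `y ↦ (x - y)⁺`. -/
def positivePartKernel : C(I, C(I, ℝ)) :=
  ContinuousMap.curry ⟨fun p : I × I => max ((p.1 : ℝ) - p.2) 0, by fun_prop⟩

theorem positivePartKernel_apply (x y : I) :
    positivePartKernel x y = max ((x : ℝ) - y) 0 := rfl

theorem norm_positivePartKernel_le (x : I) : ‖positivePartKernel x‖ ≤ 1 := by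
  rw [ContinuousMap.norm_le _ zero_le_one]
  intro y
  rw [positivePartKernel_apply, Real.norm_eq_abs, abs_of_nonneg (le_max_right _ _)]
  exact max_le (by linarith [x.2.2, y.2.1]) zero_le_one

theorem potential_eq_inner (g : μ.L2) (x : I) : potential (μ.integrable g) x =
    ⟪ContinuousMap.toLp 2 μ.meas ℝ (positivePartKernel x), g⟫ :=
  (μ.inner_eq _ g (ContinuousMap.coeFn_toLp (𝕜 := ℝ) μ.meas (positivePartKernel x)).symm
    EventuallyEq.rfl).symm

/-- The potential as a bounded operator from `L²` to `C([0,1])`. -/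
def potentialL (μ : MassDistribution) : μ.L2 →L[ℝ] C(I, ℝ) :=
  LinearMap.mkContinuous
    { toFun := fun g => potential (μ.integrable g)
      map_add' := fun f g => by
        ext x; simp only [ContinuousMap.add_apply, potential_eq_inner, inner_add_right]
      map_smul' := fun c f => by
        ext x
        simp only [ContinuousMap.smul_apply, potential_eq_inner, inner_smul_right, smul_eq_mul,
          RingHom.id_apply] }
    1 fun g => by
      rw [ContinuousMap.norm_le _ (by positivity)]
      intro x
      change ‖potential (μ.integrable g) x‖ ≤ _
      rw [potential_eq_inner]
      refine (norm_inner_le_norm _ _).trans ?_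
      gcongr
      exact (norm_toLp_le μ _).trans (norm_positivePartKernel_le x)

theorem potentialL_apply (g : μ.L2) : potentialL μ g = potential (μ.integrable g) := rfl

theorem mem_kreinFeller_of_potential (g : μ.L2) (a c : ℝ)
    (hb : b.OnDomain (potential (μ.integrable g) + (ContinuousMap.const I a + c • coordI))
      (cumulative (μ.integrable g) + (0 + c • 1))) :
    (ContinuousMap.toLp 2 μ.meas ℝ
      (potential (μ.integrable g) + (ContinuousMap.const I a + c • coordI)), g) ∈
      kreinFellerSubmodule μ b := by
  refine ⟨_, _, (ContinuousMap.coeFn_toLp μ.meas _).symm, (hasDerivOnI_potential _).add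
    ((HasDerivOnI.const a).add (hasDerivOnI_coordI.smul c)), fun x => ?_, hb⟩
  simp only [ContinuousMap.add_apply, cumulative_zero]
  rw [show cumulative (μ.integrable g) x = ∫ y in Iic x, g y ∂μ.meas from rfl]
  simp
  ring

theorem kreinFeller_dirichlet_surjective {l : ℝ} (hl : 0 < l) (k : μ.L2) :
    ∃ p ∈ kreinFellerSubmodule μ .dirichlet, l • p.1 - p.2 = k := by
  -- S inverts Δ: the potential minus the linear function matching it at 0 and 1. With p = (S g, g),
  -- the resolvent equation becomes g - l S g = -k.
  set S : μ.L2 →L[ℝ] μ.L2 := (ContinuousMap.toLp 2 μ.meas ℝ).comp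
    (potentialL μ - ((ContinuousMap.evalCLM ℝ (1 : I)).comp (potentialL μ)).smulRight coordI)
    with hSdef
  have hS : ∀ g, (S g, g) ∈ kreinFellerSubmodule μ .dirichlet := by
    intro g
    have h0 : coordI 0 = 0 := rfl
    have h1 : coordI 1 = 1 := rfl
    have := mem_kreinFeller_of_potential (b := .dirichlet) g 0 (-potential (μ.integrable g) 1)
      ⟨by simp [potential_zero, h0], by simp [h1]⟩
    convert this using 2
    rw [hSdef]
    simp only [ContinuousLinearMap.comp_apply, sub_apply,
      ContinuousLinearMap.smulRight_apply, potentialL_apply]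
    congr 1
    ext x
    simp [sub_eq_add_neg]
  obtain ⟨g, hg⟩ := exists_sub_smul_eq (S := S) (fun g => by
    rw [real_inner_comm]; exact kreinFeller_inner_nonpos _ (hS g)) hl (-k)
  refine ⟨_, hS g, ?_⟩
  simp only
  rw [← neg_sub, hg, neg_neg]

/-- Constants are annihilated by Δ and its values have mean zero. So Δ is inverted on mean-zero
functions, by the potential conjugated with the projection Q; the mean ⟪e, k⟫ of k is produced by
adding the constant ⟪e, k⟫ / l. -/
theorem kreinFeller_neumann_surjective {l : ℝ} (hl : 0 < l) (k : μ.L2) :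
    ∃ p ∈ kreinFellerSubmodule μ .neumann, l • p.1 - p.2 = k := by
  set e : μ.L2 := ContinuousMap.toLp 2 μ.meas ℝ 1 with he
  have hmean : ∀ g : μ.L2, ⟪e, g⟫ = ∫ y, g y ∂μ.meas := by
    intro g
    rw [μ.inner_eq e g (ContinuousMap.coeFn_toLp μ.meas 1).symm EventuallyEq.rfl]
    simp
  have hee : ⟪e, e⟫ = 1 := by
    rw [μ.inner_eq e e (ContinuousMap.coeFn_toLp μ.meas 1).symm
      (ContinuousMap.coeFn_toLp μ.meas 1).symm]
    simp
  set Q : μ.L2 →L[ℝ] μ.L2 := ContinuousLinearMap.id ℝ _ - (innerSL ℝ e).smulRight e with hQdef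
  have hQ : ∀ g, Q g = g - ⟪e, g⟫ • e := fun g => rfl
  have heQ : ∀ g, ⟪e, Q g⟫ = 0 := by
    intro g; rw [hQ, inner_sub_right, inner_smul_right, hee]; ring
  have hQid : ∀ g, ⟪e, g⟫ = 0 → Q g = g := fun g hg => by rw [hQ, hg, zero_smul, sub_zero]
  set S : μ.L2 →L[ℝ] μ.L2 :=
    Q.comp ((ContinuousMap.toLp 2 μ.meas ℝ).comp ((potentialL μ).comp Q)) with hSdef
  have hmem : ∀ (g : μ.L2) (c : ℝ), ⟪e, g⟫ = 0 →
      (S g + c • e, g) ∈ kreinFellerSubmodule μ .neumann := by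
    intro g c hg
    set J := ContinuousMap.toLp 2 μ.meas ℝ (potential (μ.integrable g)) with hJ
    have := mem_kreinFeller_of_potential (b := .neumann) g (c - ⟪e, J⟫) 0
      ⟨by simp [cumulative_zero], by simp [cumulative_one, ← hmean, hg]⟩
    convert this using 2
    have h1 : S g = J - ⟪e, J⟫ • e := by
      change Q (ContinuousMap.toLp 2 μ.meas ℝ (potentialL μ (Q g))) = _
      rw [hQid g hg]; rfl
    have h2 : ContinuousMap.const I (c - ⟪e, J⟫) + (0 : ℝ) • coordI =
        (c - ⟪e, J⟫) • (1 : C(I, ℝ)) := by ext x; simp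
    rw [h1, h2, map_add, map_smul, ← he, ← hJ]
    module
  have hSneg : ∀ g, ⟪S g, g⟫ ≤ 0 := by
    intro g
    have hS : S (Q g) = S g := by
      change Q (ContinuousMap.toLp 2 μ.meas ℝ (potentialL μ (Q (Q g)))) = _
      rw [hQid _ (heQ g)]; rfl
    have h1 := kreinFeller_inner_nonpos _ (hmem (Q g) 0 (heQ g))
    simp only [zero_smul, add_zero, hS] at h1
    have h2 : g = Q g + ⟪e, g⟫ • e := by rw [hQ]; abel
    have h3 : ⟪S g, e⟫ = 0 := by rw [real_inner_comm]; exact heQ _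
    rw [h2, inner_add_right, inner_smul_right, ← h2, h3, mul_zero, add_zero, real_inner_comm]
    exact h1
  obtain ⟨g, hg⟩ := exists_sub_smul_eq hSneg hl (-Q k)
  have heg : ⟪e, g⟫ = 0 := by
    have h1 := congrArg (fun z => ⟪e, z⟫) hg
    have h2 : ⟪e, S g⟫ = 0 := heQ _
    simp only [inner_sub_right, inner_smul_right, inner_neg_right, heQ, h2] at h1
    linarith
  refine ⟨_, hmem g (l⁻¹ * ⟪e, k⟫) heg, ?_⟩
  have h1 : l • S g - g = Q k := by rw [← neg_sub, hg, neg_neg]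
  have h2 : l • (l⁻¹ * ⟪e, k⟫) • e = ⟪e, k⟫ • e := by
    rw [smul_smul, mul_inv_cancel_left₀ hl.ne']
  simp only
  rw [smul_add, h2, add_sub_right_comm, h1, hQ]
  abel

theorem kreinFeller_surjective (l : ℝ) (hl : 0 < l) (k : μ.L2) :
    ∃ p ∈ kreinFellerSubmodule μ b, l • p.1 - p.2 = k := by
  cases b
  · exact kreinFeller_neumann_surjective hl k
  · exact kreinFeller_dirichlet_surjective hl k

theorem exists_toL2_eq_of_mem_domain {p : μ.L2 × μ.L2} (hp : p ∈ kreinFellerSubmodule μ b) :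
    ∃ f : CSpace μ b, CSpace.toL2 f = p.1 := by
  obtain ⟨F, F', hF, -, -, hb⟩ := hp
  exact ⟨⟨p.1, F, hF, hb.onContinuous⟩, rfl⟩

theorem kreinFellerBar_surjective (l : ℝ) (hl : 0 < l) (k : CSpace μ b) :
    ∃ p ∈ kreinFellerBarSubmodule μ b, l • p.1 - p.2 = k := by
  obtain ⟨p, hp, hpk⟩ := kreinFeller_surjective (b := b) l hl (CSpace.toL2 k)
  obtain ⟨f, hf⟩ := exists_toL2_eq_of_mem_domain hp
  refine ⟨(f, l • f - k), ?_, by simp⟩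
  change (CSpace.toL2 f, CSpace.toL2 (l • f - k)) ∈ kreinFellerSubmodule μ b
  have : CSpace.toL2 (l • f - k) = p.2 := by
    rw [map_sub, map_smul, hf, ← hpk]; abel
  rw [hf, this]
  exact hp

end Resolvent

section Density

open scoped RealInnerProductSpace

variable {μ : MassDistribution} {b : BoundaryCondition}

/-! ### Completeness of the space of continuous functions -/

namespace CSpace

theorem restrictSupp_ofCont (F : C(I, ℝ)) (hF : b.OnContinuous F) :
    restrictSupp (ofCont F hF : CSpace μ b) = F.restrict μ.supp := by
  ext x
  exact eqOn_supp ((rep_ae (ofCont F hF : CSpace μ b)).trans (ofCont_ae F hF).symm) x.2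

/-- Tietze extension. The range is closed, which gives completeness. -/
theorem range_restrictSupp : range (restrictSupp : CSpace μ b → C(μ.supp, ℝ)) =
    {φ | b = .dirichlet → φ ⟨0, μ.zero_mem⟩ = 0 ∧ φ ⟨1, μ.one_mem⟩ = 0} := by
  ext φ
  constructor
  · rintro ⟨f, rfl⟩ rfl
    exact f.rep_onContinuous
  · intro h
    obtain ⟨F, hF⟩ := ContinuousMap.exists_restrict_eq
      (Measure.isClosed_support (μ := μ.meas)) φ
    have hb : b.OnContinuous F := by
      subst hF
      cases b
      · trivial
      · exact h rfl
    exact ⟨ofCont F hb, (restrictSupp_ofCont F hb).trans hF⟩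

instance : CompleteSpace (CSpace μ b) := by
  have hiso : Isometry (restrictSupp : CSpace μ b → C(μ.supp, ℝ)) :=
    AddMonoidHomClass.isometry_of_norm _ fun _ => rfl
  rw [completeSpace_iff_isComplete_range hiso.isUniformInducing, range_restrictSupp]
  refine IsClosed.isComplete ?_
  by_cases hb : b = .dirichlet
  · simp only [hb, true_imp_iff]
    exact (isClosed_eq (continuous_eval_const _) continuous_const).inter
      (isClosed_eq (continuous_eval_const _) continuous_const)
  · simp [hb]

theorem norm_ofCont_sub_le {F : C(I, ℝ)} {hF : b.OnContinuous F} {f : CSpace μ b} {G : C(I, ℝ)}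
    (hG : (G : I → ℝ) =ᵐ[μ.meas] toL2 f) {K : ℝ} (hK : 0 ≤ K)
    (h : ∀ x ∈ μ.supp, |F x - G x| ≤ K) : ‖ofCont F hF - f‖ ≤ K := by
  rw [norm_le_iff (F := fun x => F x - G x) hK]
  · filter_upwards [Measure.support_mem_ae (μ := μ.meas)] with x hx using h x hx
  · rw [map_sub]
    filter_upwards [Lp.coeFn_sub (toL2 (ofCont F hF : CSpace μ b)) (toL2 f), hG,
      ofCont_ae (μ := μ) F hF] with x h1 h2 h3
    rw [h1, Pi.sub_apply, h2, h3]

end CSpace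

/-! ### Density of the domain -/

/-- Finitely many balls of radius δ / 2 centred in the support cover it, and each ball of radius δ
around a point of the support contains one of them. This converts L²-smallness into uniform
smallness on the support. -/
theorem exists_pos_le_measure_ball (μ : MassDistribution) {δ : ℝ} (hδ : 0 < δ) :
    ∃ c : ℝ, 0 < c ∧ ∀ x ∈ μ.supp, c ≤ μ.meas.real (Metric.ball x δ) := by
  obtain ⟨t, hts, htf, hcov⟩ := (Measure.isClosed_support (μ := μ.meas)).isCompact.finite_cover_balls
    (half_pos hδ)
  have hne : htf.toFinset.Nonempty := by
    obtain ⟨y, hy, -⟩ := mem_iUnion₂.1 (hcov μ.zero_mem)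
    exact ⟨y, htf.mem_toFinset.2 hy⟩
  obtain ⟨z, hz, hmin⟩ := htf.toFinset.exists_min_image (fun y => μ.meas.real (Metric.ball y (δ / 2)))
    hne
  refine ⟨μ.meas.real (Metric.ball z (δ / 2)), ?_, fun x hx => ?_⟩
  · have := (Measure.mem_support_iff_forall z).1 (hts (htf.mem_toFinset.1 hz)) _
      (Metric.ball_mem_nhds z (half_pos hδ))
    exact ENNReal.toReal_pos this.ne' (measure_ne_top _ _)
  · obtain ⟨y, hy, hxy⟩ := mem_iUnion₂.1 (hcov hx)
    refine (hmin y (htf.mem_toFinset.2 hy)).trans (measureReal_mono ?_)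
    refine Metric.ball_subset_ball' ?_
    rw [dist_comm]
    linarith [Metric.mem_ball.1 hxy]

/-- Integrates |F'| ≤ ε F'² + 1 / ε, an additive substitute for the Hölder-1/2 bound. -/
theorem HasDerivOnI.abs_sub_le {F F' : C(I, ℝ)} (hF : HasDerivOnI F F') {C ε : ℝ} (hε : 0 < ε)
    (hC : ∫ t in Ioc (0 : ℝ) 1, IccExtend zero_le_one F' t ^ 2 ≤ C) (x y : I) :
    |F x - F y| ≤ ε * C + |(x : ℝ) - y| / ε := by
  wlog hxy : x ≤ y generalizing x y
  · rw [abs_sub_comm, abs_sub_comm (x : ℝ)]; exact this y x (le_of_not_ge hxy)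
  set h' : ℝ → ℝ := IccExtend zero_le_one F' with hh'
  have hc : Continuous h' := F'.continuous.Icc_extend'
  have hxy' : (x : ℝ) ≤ y := hxy
  rw [abs_sub_comm, ← hF.integral_eq x y hxy, abs_sub_comm, abs_of_nonneg (sub_nonneg.2 hxy'),
    ← Real.norm_eq_abs]
  have h1 : ∀ t, ‖h' t‖ ≤ ε * h' t ^ 2 + 1 / ε := by
    intro t
    rw [Real.norm_eq_abs]
    have h2 : 0 < 1 / ε := by positivity
    have h3 : 1 / ε * (ε * |h' t| - 1) ^ 2 = ε * h' t ^ 2 - 2 * |h' t| + 1 / ε := by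
      rw [← sq_abs (h' t)]; field_simp; ring
    have h4 := mul_nonneg h2.le (sq_nonneg (ε * |h' t| - 1))
    linarith [abs_nonneg (h' t)]
  refine (intervalIntegral.norm_integral_le_of_norm_le (g := fun t => ε * h' t ^ 2 + 1 / ε) hxy'
    (Eventually.of_forall fun t _ => h1 t) ((by fun_prop : Continuous _).intervalIntegrable _ _)).trans ?_
  rw [intervalIntegral.integral_add ((by fun_prop : Continuous _).intervalIntegrable _ _)
    intervalIntegrable_const, intervalIntegral.integral_const_mul, intervalIntegral.integral_const,
    smul_eq_mul, mul_one_div]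
  gcongr
  refine le_trans ?_ hC
  rw [intervalIntegral.integral_of_le hxy']
  refine setIntegral_mono_set ?_ (Eventually.of_forall fun t => sq_nonneg _) ?_
  · exact ((by fun_prop : Continuous fun t => h' t ^ 2).integrableOn_Icc).mono_set Ioc_subset_Icc_self
  · exact (Ioc_subset_Ioc x.2.1 y.2.2).eventuallyLE

/-- G is l(l - Δ)⁻¹F. Testing with G - F and writing d = G' - F', the left-hand side becomes ∫ (F'²
- (d + F')²). The bound does not depend on l. -/
theorem resolvent_energy_bound {F F' : C(I, ℝ)} (hF : HasDerivOnI F F') (hb : b.OnContinuous F)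
    {l : ℝ} {p : μ.L2 × μ.L2} {G G' : C(I, ℝ)}
    (hG : (G : I → ℝ) =ᵐ[μ.meas] p.1) (hGd : HasDerivOnI G G')
    (hG' : ∀ x : I, G' x = G' 0 + ∫ y in Iic x, p.2 y ∂μ.meas) (hGb : b.OnDomain G G')
    (hp : l • p.1 - p.2 = l • ContinuousMap.toLp 2 μ.meas ℝ F) :
    2 * l * ∫ y, (G y - F y) ^ 2 ∂μ.meas +
      ∫ t in Ioc (0 : ℝ) 1, IccExtend zero_le_one ⇑(G' - F') t ^ 2 ≤ ‖F'‖ ^ 2 := by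
  have hHb : b.OnContinuous (G - F) := by
    have := hGb.onContinuous
    cases b
    · trivial
    · exact ⟨by simp [this.1, hb.1], by simp [this.2, hb.2]⟩
  have hw := kreinFeller_weak_form hG' hGb (hGd.sub hF) hHb
  have hp2 : ∀ᵐ y ∂μ.meas, p.2 y = l * (G y - F y) := by
    have hp' : p.2 = l • p.1 - l • ContinuousMap.toLp 2 μ.meas ℝ F := by rw [← hp]; abel
    rw [hp']
    filter_upwards [hG, Lp.coeFn_sub (l • p.1) (l • ContinuousMap.toLp 2 μ.meas ℝ F),
      Lp.coeFn_smul l p.1, Lp.coeFn_smul l (ContinuousMap.toLp 2 μ.meas ℝ F),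
      ContinuousMap.coeFn_toLp (p := 2) (𝕜 := ℝ) μ.meas F] with y h1 h2 h3 h4 h5
    rw [h2, Pi.sub_apply, h3, h4, Pi.smul_apply, Pi.smul_apply, h5, ← h1, smul_eq_mul, smul_eq_mul]
    ring
  have hleft : ∫ y, p.2 y * (G - F) y ∂μ.meas = l * ∫ y, (G y - F y) ^ 2 ∂μ.meas := by
    rw [← integral_const_mul]
    refine integral_congr_ae ?_
    filter_upwards [hp2] with y hy
    rw [hy, ContinuousMap.sub_apply]; ring
  rw [hleft] at hw
  set d : ℝ → ℝ := IccExtend zero_le_one ⇑(G' - F') with hd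
  set f : ℝ → ℝ := IccExtend zero_le_one F' with hf
  have hcd : Continuous d := (G' - F').continuous.Icc_extend'
  have hcf : Continuous f := F'.continuous.Icc_extend'
  have hG'e : ∀ t, IccExtend zero_le_one G' t = d t + f t := fun t => by
    simp [hd, hf, IccExtend]
  have hI : ∀ u : ℝ → ℝ, Continuous u → IntegrableOn u (Ioc (0 : ℝ) 1) := fun u hu =>
    hu.integrableOn_Icc.mono_set Ioc_subset_Icc_self
  have h2 : 2 * (l * ∫ y, (G y - F y) ^ 2 ∂μ.meas) + ∫ t in Ioc (0 : ℝ) 1, d t ^ 2 ≤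
      ∫ t in Ioc (0 : ℝ) 1, f t ^ 2 := by
    rw [hw, mul_neg, ← integral_const_mul, neg_add_eq_sub,
      ← integral_sub (f := fun t => d t ^ 2)
        (g := fun t => 2 * (d t * IccExtend zero_le_one G' t)) (hI _ (hcd.pow 2))
        (hI _ (continuous_const.mul (hcd.mul G'.continuous.Icc_extend')))]
    refine setIntegral_mono (hI _ ((hcd.pow 2).sub
      (continuous_const.mul (hcd.mul G'.continuous.Icc_extend')))) (hI _ (by fun_prop)) fun t => ?_
    simp only [hG'e]
    nlinarith [sq_nonneg (d t + f t)]
  have h3 : ∫ t in Ioc (0 : ℝ) 1, f t ^ 2 ≤ ‖F'‖ ^ 2 := by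
    have h4 : ∫ t in Ioc (0 : ℝ) 1, f t ^ 2 ≤ ∫ t in Ioc (0 : ℝ) 1, ‖F'‖ ^ 2 := by
      refine setIntegral_mono (hI _ (by fun_prop)) (hI _ continuous_const) fun t => ?_
      simp only
      rw [← sq_abs]
      exact pow_le_pow_left₀ (abs_nonneg _) (F'.norm_coe_le_norm _) 2
    simpa using h4
  linarith

theorem exists_mem_kreinFellerBar_near_of_hasDerivOnI {F F' : C(I, ℝ)} (hF : HasDerivOnI F F')
    (hb : b.OnContinuous F) {ε : ℝ} (hε : 0 < ε) :
    ∃ p ∈ kreinFellerBarSubmodule μ b, ‖CSpace.ofCont F hb - p.1‖ ≤ ε := by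
  set C := ‖F'‖ ^ 2 with hCdef
  have hC : 0 ≤ C := by positivity
  -- η and δ make G - F oscillate by at most ε / 2 on δ-balls. If |G - F| > ε at a point of the
  -- support, then (G - F)² ≥ (ε / 2)² on a ball of mass at least c, against the energy bound for
  -- the l chosen below.
  set η := ε / (4 * (C + 1)) with hη
  have hη0 : 0 < η := by positivity
  have hηC : η * C ≤ ε / 4 := by
    rw [hη, div_mul_eq_mul_div, div_le_div_iff₀ (by positivity) (by positivity)]; nlinarith
  set δ := η * (ε / 4) with hδ
  have hδ0 : 0 < δ := by positivity
  obtain ⟨c, hc, hball⟩ := exists_pos_le_measure_ball μ hδ0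
  obtain ⟨l, hl0, hl⟩ : ∃ l : ℝ, 0 < l ∧ C < 2 * l * ((ε / 2) ^ 2 * c) := by
    refine ⟨(C + 1) / (2 * ((ε / 2) ^ 2 * c)), by positivity, ?_⟩
    rw [mul_div_assoc', mul_comm, mul_div_assoc', lt_div_iff₀ (by positivity)]
    have : 0 < (ε / 2) ^ 2 * c := by positivity
    nlinarith
  obtain ⟨p, hp, hpk⟩ := kreinFellerBar_surjective l hl0 (l • CSpace.ofCont F hb : CSpace μ b)
  refine ⟨p, hp, ?_⟩
  obtain ⟨G, G', hG, hGd, hG', hGb⟩ := hp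
  have hen := resolvent_energy_bound hF hb hG hGd hG' hGb (by
    rw [← CSpace.toL2_ofCont F hb]
    have := congrArg CSpace.toL2 hpk
    simpa using this)
  rw [← hCdef] at hen
  have hint2 : 0 ≤ ∫ y, (G y - F y) ^ 2 ∂μ.meas := integral_nonneg fun y => sq_nonneg _
  have hen2 : ∫ t in Ioc (0 : ℝ) 1, IccExtend zero_le_one ⇑(G' - F') t ^ 2 ≤ C := by
    have := mul_nonneg (mul_pos two_pos hl0).le hint2
    linarith
  have hen1 : 2 * l * ∫ y, (G y - F y) ^ 2 ∂μ.meas ≤ C := by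
    have : 0 ≤ ∫ t in Ioc (0 : ℝ) 1, IccExtend zero_le_one ⇑(G' - F') t ^ 2 :=
      integral_nonneg fun t => sq_nonneg _
    linarith
  refine CSpace.norm_ofCont_sub_le hG hε.le fun x hx => ?_
  by_contra! hlt
  have hnear : ∀ y ∈ Metric.ball x δ, (ε / 2) ^ 2 ≤ (G y - F y) ^ 2 := by
    intro y hy
    have h1 := (HasDerivOnI.sub hGd hF).abs_sub_le hη0 hen2 x y
    have h2 : |(x : ℝ) - y| / η ≤ ε / 4 := by
      rw [div_le_iff₀ hη0, mul_comm, ← hδ]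
      have : dist y x < δ := hy
      rw [dist_comm, Subtype.dist_eq, Real.dist_eq] at this
      exact this.le
    simp only [ContinuousMap.sub_apply] at h1
    have h3 : ε / 2 ≤ |G y - F y| := by
      have h4 := abs_sub_abs_le_abs_sub (G x - F x) (G y - F y)
      rw [abs_sub_comm] at hlt
      linarith
    rw [← sq_abs (G y - F y)]
    exact pow_le_pow_left₀ (by positivity) h3 2
  have hsq : Continuous fun y => (G y - F y) ^ 2 := by fun_prop
  have hlow : (ε / 2) ^ 2 * c ≤ ∫ y, (G y - F y) ^ 2 ∂μ.meas := by
    calc (ε / 2) ^ 2 * c ≤ (ε / 2) ^ 2 * μ.meas.real (Metric.ball x δ) := by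
          gcongr; exact hball x hx
      _ = ∫ y in Metric.ball x δ, (ε / 2) ^ 2 ∂μ.meas := by
          rw [setIntegral_const, smul_eq_mul, mul_comm]
      _ ≤ ∫ y in Metric.ball x δ, (G y - F y) ^ 2 ∂μ.meas :=
          setIntegral_mono_on (integrable_const _).integrableOn
            (μ.integrable_cont ⟨_, hsq⟩).integrableOn measurableSet_ball hnear
      _ ≤ ∫ y, (G y - F y) ^ 2 ∂μ.meas :=
          setIntegral_le_integral (μ.integrable_cont ⟨_, hsq⟩)
            (Eventually.of_forall fun y => sq_nonneg _)
  have := mul_le_mul_of_nonneg_left hlow (mul_pos two_pos hl0).le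
  linarith

theorem exists_hasDerivOnI_near (F : C(I, ℝ)) (hb : b.OnContinuous F) {ε : ℝ} (hε : 0 < ε) :
    ∃ G G' : C(I, ℝ), HasDerivOnI G G' ∧ b.OnContinuous G ∧ ∀ x, |G x - F x| ≤ ε := by
  obtain ⟨p, hp⟩ := exists_polynomial_near_continuousMap 0 1 F (ε / 2) (half_pos hε)
  have hpx : ∀ x : I, |p.eval (x : ℝ) - F x| ≤ ε / 2 := fun x =>
    ((p.toContinuousMapOn I - F).norm_coe_le_norm x).trans hp.le
  have hpd : HasDerivOnI (p.toContinuousMapOn I) (p.derivative.toContinuousMapOn I) :=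
    hasDerivOnI_of_hasDerivAt (Φ := fun s => p.eval s) (fun _ => rfl) fun x => p.hasDerivAt x
  cases b
  · exact ⟨_, _, hpd, trivial, fun x => (hpx x).trans (by linarith)⟩
  -- Subtracting the chord restores the zero boundary values; its end values are at most ε / 2,
  -- which is why the polynomial is taken within ε / 2.
  · refine ⟨_, _, hpd.sub ((HasDerivOnI.const (p.eval 0)).add
      (hasDerivOnI_coordI.smul (p.eval 1 - p.eval 0))), ⟨?_, ?_⟩, fun x => ?_⟩
    · change p.eval 0 - (p.eval 0 + (p.eval 1 - p.eval 0) * 0) = 0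
      ring
    · change p.eval 1 - (p.eval 0 + (p.eval 1 - p.eval 0) * 1) = 0
      ring
    · have h0 := hpx 0
      have h1 := hpx 1
      have hx := hpx x
      rw [hb.1] at h0
      rw [hb.2] at h1
      change |p.eval (x : ℝ) - (p.eval 0 + (p.eval 1 - p.eval 0) * x) - F x| ≤ ε
      change |p.eval (0 : ℝ) - 0| ≤ ε / 2 at h0
      change |p.eval (1 : ℝ) - 0| ≤ ε / 2 at h1
      rw [abs_le] at *
      have hx0 : 0 ≤ (x : ℝ) := x.2.1
      have hx1 : (x : ℝ) ≤ 1 := x.2.2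
      constructor <;> nlinarith

theorem kreinFellerBar_dense :
    Dense (Prod.fst '' (kreinFellerBarSubmodule μ b : Set (CSpace μ b × CSpace μ b))) := by
  rw [Metric.dense_iff]
  intro f ε hε
  obtain ⟨G, G', hG, hGb, hGF⟩ := exists_hasDerivOnI_near f.rep f.rep_onContinuous
    (show 0 < ε / 3 by positivity)
  obtain ⟨p, hp, hpG⟩ := exists_mem_kreinFellerBar_near_of_hasDerivOnI (μ := μ) hG hGb
    (show 0 < ε / 3 by positivity)
  refine ⟨p.1, ?_, p, hp, rfl⟩
  have h1 : ‖CSpace.ofCont G hGb - f‖ ≤ ε / 3 :=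
    CSpace.norm_ofCont_sub_le (CSpace.rep_ae f) (by positivity) fun x _ => hGF x
  rw [Metric.mem_ball, dist_eq_norm]
  have h2 : p.1 - f = (CSpace.ofCont G hGb - f) - (CSpace.ofCont G hGb - p.1) := by abel
  rw [h2]
  have := norm_sub_le (CSpace.ofCont G hGb - f) (CSpace.ofCont G hGb - p.1)
  linarith

/-- Let y be orthogonal to the range and w(x) = x(1 - x). Products F w satisfy either boundary
condition, so w y is orthogonal to all continuous F and vanishes; w is zero only at the end points,
which are not atoms. -/
theorem CSpace.denseRange_toL2L : DenseRange (CSpace.toL2L : CSpace μ b → μ.L2) := by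
  have hrange : range (CSpace.toL2L : CSpace μ b → μ.L2) = contSubmodule μ b :=
    Subtype.range_coe
  rw [DenseRange, hrange, Submodule.dense_iff_topologicalClosure_eq_top,
    Submodule.topologicalClosure_eq_top_iff, Submodule.eq_bot_iff]
  intro y hy
  set w : C(I, ℝ) := ⟨fun x => (x : ℝ) * (1 - x), by fun_prop⟩ with hw
  have hwy : MemLp (fun x => w x * y x) 2 μ.meas :=
    (Lp.memLp y).of_le_mul (c := ‖w‖) (w.continuous.aestronglyMeasurable.mul
      (Lp.memLp y).aestronglyMeasurable) (Eventually.of_forall fun x => by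
        rw [norm_mul]; gcongr; exact w.norm_coe_le_norm x)
  have hz : hwy.toLp = 0 := by
    refine Dense.eq_zero_of_inner_left (𝕜 := ℝ) 
      (S := range (ContinuousMap.toLp 2 μ.meas ℝ : C(I, ℝ) → μ.L2)) ?_ ?_
    · exact ContinuousMap.toLp_denseRange ℝ μ.meas ℝ (by simp)
    · rintro _ ⟨F, rfl⟩
      have hb : b.OnContinuous (F * w) := by
        cases b
        · trivial
        · exact ⟨by simp [hw], by simp [hw]⟩
      have h1 : ⟪toL2 (ofCont (F * w) hb : CSpace μ b), y⟫ = 0 := hy _ (ofCont (F * w) hb).2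
      rw [μ.inner_eq _ y (ofCont_ae (F * w) hb) EventuallyEq.rfl] at h1
      change ⟪hwy.toLp, ContinuousMap.toLp 2 μ.meas ℝ F⟫ = 0
      rw [real_inner_comm, μ.inner_eq _ _ (ContinuousMap.coeFn_toLp (𝕜 := ℝ) μ.meas F).symm
        hwy.coeFn_toLp.symm, ← h1]
      refine integral_congr_ae (Eventually.of_forall fun x => ?_)
      simp only [ContinuousMap.mul_apply]; ring
  have h0 : ∀ᵐ x ∂μ.meas, w x * y x = 0 := by
    have h1 := hwy.coeFn_toLp
    rw [hz] at h1
    filter_upwards [h1, Lp.coeFn_zero ℝ 2 μ.meas] with x h2 h3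
    rw [← h2, h3]; rfl
  refine Lp.ext ?_
  have hne : ∀ z : I, ∀ᵐ x ∂μ.meas, x ≠ z := fun z => by simp [ae_iff]
  filter_upwards [h0, hne 0, hne 1, Lp.coeFn_zero ℝ 2 μ.meas] with x h1 h2 h3 h4
  rw [h4]
  refine (mul_eq_zero.1 h1).resolve_left (mul_ne_zero ?_ ?_)
  · exact fun h => h2 (Subtype.ext h)
  · exact fun h => h3 (Subtype.ext (sub_eq_zero.1 h).symm)

theorem kreinFeller_dense :
    Dense (Prod.fst '' (kreinFellerSubmodule μ b : Set (μ.L2 × μ.L2))) := by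
  refine (CSpace.denseRange_toL2L.dense_image CSpace.toL2L.continuous
    (kreinFellerBar_dense (b := b))).mono ?_
  rintro _ ⟨_, ⟨p, hp, rfl⟩, rfl⟩
  exact ⟨_, hp, rfl⟩

/-! ### Generation -/

theorem generates_heatSemigroup (μ : MassDistribution) (b : BoundaryCondition) :
    Generates (kreinFeller μ b) (heatSemigroup μ b) := by
  obtain ⟨T, hT, -⟩ := (kreinFeller_dissipative (μ := μ) (b := b)).exists_generates
    kreinFeller_surjective kreinFeller_dense
  exact Classical.epsilon_spec (p := Generates (kreinFeller μ b)) ⟨T, hT⟩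

theorem exists_generates_kreinFellerBar (μ : MassDistribution) (b : BoundaryCondition) :
    ∃ T : ℝ≥0 → CSpace μ b →L[ℝ] CSpace μ b, Generates (kreinFellerBar μ b) T ∧
      ∀ t f, ‖T t f‖ ≤ ‖f‖ :=
  kreinFellerBar_dissipative.exists_generates kreinFellerBar_surjective kreinFellerBar_dense

theorem toL2_semigroup {T : ℝ≥0 → CSpace μ b →L[ℝ] CSpace μ b}
    (hT : Generates (kreinFellerBar μ b) T) (t : ℝ≥0) (f : CSpace μ b) :
    CSpace.toL2 (T t f) = heatSemigroup μ b t (CSpace.toL2 f) :=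
  hT.intertwine (B := kreinFellerSubmodule μ b) (generates_heatSemigroup μ b)
    kreinFeller_dissipative kreinFellerBar_dense CSpace.toL2L (fun _ hp => hp) t f

/-- The semigroup on continuous functions solves the Cauchy problem for every initial value. -/
theorem isSolution_kreinFellerBar {T : ℝ≥0 → CSpace μ b →L[ℝ] CSpace μ b}
    (hT : Generates (kreinFellerBar μ b) T) (f : CSpace μ b) :
    IsSolution (kreinFellerBar μ b) f (fun t => T t f) := by
  have hS := generates_heatSemigroup μ b
  have hsm : ∀ (t : ℝ≥0), 0 < t → ∀ x, ∃ y, (heatSemigroup μ b t x, y) ∈ kreinFellerSubmodule μ b :=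
    fun t ht x => Generates.smoothing (A := kreinFellerSubmodule μ b) kreinFeller_inner_nonpos
      kreinFeller_symm (kreinFeller_surjective 1 one_pos) kreinFeller_dense hS ht x
  refine hT.isSolution fun t ht => ?_
  -- Smoothing over two half-times: the first gives y = Δ T_{t/2} f, the second puts T_{t/2} y = Δ
  -- T_t f in the domain, hence among the continuous classes.
  obtain ⟨y, hy⟩ := hsm (t / 2) (half_pos ht) (CSpace.toL2 f)
  obtain ⟨z, hz⟩ := hsm (t / 2) (half_pos ht) y
  obtain ⟨g, hg⟩ := exists_toL2_eq_of_mem_domain hz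
  refine ⟨g, ?_⟩
  change (CSpace.toL2 (T t f), CSpace.toL2 g) ∈ kreinFeller μ b
  rw [hg, toL2_semigroup hT]
  have := hS.orbit_mem hy (t / 2)
  simp only at this
  rwa [← ContinuousLinearMap.comp_apply, ← hS.1.map_add, add_halves] at this

end Density

/-! ### Approximation of semigroups on varying spaces -/

/-- A finite net with radius adapted to the common Lipschitz constant. It serves for compact orbits
and for the compact family of potential kernels. -/
theorem eventually_forall_abs_le_of_isCompact {X : Type*} [PseudoMetricSpace X] {N : ℕ → X → ℝ}
    {C : ℝ} (hC : 0 ≤ C) (hN : ∀ n x y, |N n x - N n y| ≤ C * dist x y)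
    (h : ∀ x, Tendsto (fun n => N n x) atTop (𝓝 0)) {K : Set X} (hK : IsCompact K) {ε : ℝ}
    (hε : 0 < ε) : ∀ᶠ n in atTop, ∀ x ∈ K, |N n x| ≤ ε := by
  obtain ⟨t, -, htf, hcov⟩ := hK.finite_cover_balls (e := ε / (2 * (C + 1))) (by positivity)
  have h1 : ∀ᶠ n in atTop, ∀ y ∈ t, |N n y| < ε / 2 := by
    rw [eventually_all_finite htf]
    intro y _
    have := (Metric.tendsto_nhds.1 (h y)) (ε / 2) (half_pos hε)
    simpa [Real.dist_eq] using this
  filter_upwards [h1] with n hn x hx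
  obtain ⟨y, hy, hxy⟩ := mem_iUnion₂.1 (hcov hx)
  have h2 := hN n x y
  have h3 := hn y hy
  have h4 : C * dist x y ≤ ε / 2 := by
    have h5 := Metric.mem_ball.1 hxy
    rw [lt_div_iff₀ (by positivity)] at h5
    nlinarith [dist_nonneg (x := x) (y := y)]
  have h6 := abs_sub_abs_le_abs_sub (N n x) (N n y)
  linarith

section TrotterKato

variable {X : Type*} [NormedAddCommGroup X] [NormedSpace ℝ X] [CompleteSpace X]
  {Y : ℕ → Type*} [∀ n, NormedAddCommGroup (Y n)] [∀ n, NormedSpace ℝ (Y n)]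
  [∀ n, CompleteSpace (Y n)]

/-- Trotter-Kato: strong convergence of resolvents implies convergence of contraction semigroups,
uniformly on bounded time intervals, for spaces varying with `n`. -/
theorem trotter_kato {A : Submodule ℝ (X × X)} {B : ∀ n, Submodule ℝ (Y n × Y n)}
    (hA : Dissipative A) (hB : ∀ n, Dissipative (B n))
    (hAd : Dense (Prod.fst '' (A : Set (X × X))))
    (hAs : ∀ k, ∃ p ∈ A, (1 : ℝ) • p.1 - p.2 = k)
    (hBs : ∀ n, ∀ k, ∃ p ∈ B n, (1 : ℝ) • p.1 - p.2 = k)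
    {T : ℝ≥0 → X →L[ℝ] X} {S : ∀ n, ℝ≥0 → Y n →L[ℝ] Y n}
    (hT : Generates (A : Set (X × X)) T) (hS : ∀ n, Generates (B n : Set (Y n × Y n)) (S n))
    (hTc : ∀ t x, ‖T t x‖ ≤ ‖x‖) (hSc : ∀ n t x, ‖S n t x‖ ≤ ‖x‖)
    {π : ∀ n, X →L[ℝ] Y n} (hπ : ∀ n x, ‖π n x‖ ≤ ‖x‖)
    (hres : ∀ k : X, ∀ p ∈ A, p.1 - p.2 = k → ∀ q : ∀ n, Y n × Y n, (∀ n, q n ∈ B n) →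
      (∀ n, (q n).1 - (q n).2 = π n k) → Tendsto (fun n => ‖π n p.1 - (q n).1‖) atTop (𝓝 0))
    (f : X) (τ : ℝ≥0) {ε : ℝ} (hε : 0 < ε) :
    ∀ᶠ n in atTop, ∀ t ≤ τ, ‖π n (T t f) - S n t (π n f)‖ ≤ ε := by
  obtain ⟨R, hR, hRA, hRn⟩ := hA.exists_resolvent one_pos hAs
  choose Q hQ hQA hQn using fun n => (hB n).exists_resolvent one_pos (hBs n)
  simp only [one_smul] at hR hRA hRn hQ hQA hQn
  set N : ℕ → X → ℝ := fun n x => ‖π n (R x) - Q n (π n x)‖ with hNdef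
  have hN0 : ∀ x, Tendsto (fun n => N n x) atTop (𝓝 0) := fun x =>
    hres x _ (hR x) (by simp) (fun n => (Q n (π n x), Q n (π n x) - π n x)) (fun n => hQ n _)
      (fun n => by simp)
  have hNlip : ∀ n x y, |N n x - N n y| ≤ 2 * dist x y := by
    intro n x y
    refine (abs_norm_sub_norm_le _ _).trans ?_
    have e : π n (R x) - Q n (π n x) - (π n (R y) - Q n (π n y)) =
        π n (R (x - y)) - Q n (π n (x - y)) := by simp only [map_sub]; abel
    rw [e, dist_eq_norm]
    have h1 := (hπ n (R (x - y))).trans (hRn _)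
    have h2 := (hQn n (π n (x - y))).trans (hπ n _)
    have h3 := norm_sub_le (π n (R (x - y))) (Q n (π n (x - y)))
    linarith
  have hcomm : ∀ t x, T t (R x) = R (T t x) := by
    intro t x
    have := hRA _ (hT.orbit_mem (hR x) t)
    simp only [map_sub, sub_sub_cancel] at this
    simpa using this.symm
  have horb : ∀ g, IsCompact ((fun t => T t g) '' Iic τ) := fun g => by
    have : (Iic τ : Set ℝ≥0) = Icc 0 τ := by ext; simp
    rw [this]
    exact isCompact_Icc.image (hT.1.continuous_orbit g)
  have hunif : ∀ g, ∀ η : ℝ, 0 < η → ∀ᶠ n in atTop, ∀ t ≤ τ, N n (T t g) ≤ η := by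
    intro g η hη
    filter_upwards [eventually_forall_abs_le_of_isCompact zero_le_two hNlip hN0 (horb g) hη]
      with n hn t ht
    exact (le_abs_self _).trans (hn _ ⟨t, ht, rfl⟩)
  -- After Q n both terms lie in the domain of B n. Their difference solves w' = B n w + e, where
  -- e(s) is exactly the resolvent discrepancy π R - Q π at T s g.
  have hcore : ∀ g n, ∀ η : ℝ, (∀ t ≤ τ, N n (T t g) ≤ η) → ∀ t ≤ τ,
      ‖Q n (π n (T t (R g))) - S n t (Q n (π n (R g)))‖ ≤ η * t := by
    intro g n η hη t ht
    have hRg : (R g, R g - g) ∈ generator T := by rw [hT.2]; exact hR g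
    have hv0 : (Q n (π n (R g)), Q n (π n (R g)) - π n (R g)) ∈ generator (S n) := by
      rw [(hS n).2]; exact hQ n _
    have h1 := (hB n).norm_le (τ := t) (C := η)
      (w := fun s => Q n (π n (T s.toNNReal (R g))) - S n s.toNNReal (Q n (π n (R g))))
      (y := fun s => (Q n (π n (T s.toNNReal (R g))) - π n (T s.toNNReal (R g))) -
        S n s.toNNReal (Q n (π n (R g)) - π n (R g)))
      (e := fun s => π n (R (T s.toNNReal g)) - Q n (π n (T s.toNNReal g))) t.coe_nonneg ?_ ?_
    · simpa [hT.1.map_zero, (hS n).1.map_zero] using h1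
    · exact ((((Q n).continuous.comp (π n).continuous).comp (hT.1.continuous_orbit_real _)).sub
        ((hS n).1.continuous_orbit_real _)).continuousOn
    · intro s hs
      refine ⟨(B n).sub_mem (hQ n _) ((hS n).orbit_mem (hQ n _) _), ?_, ?_⟩
      · have hd1 := ((Q n).comp (π n)).hasFDerivAt.comp_hasDerivAt s (hT.1.hasDerivAt_orbit hRg hs.1)
        have hd2 := (hS n).1.hasDerivAt_orbit hv0 hs.1
        refine (hd1.sub hd2).congr_deriv ?_
        simp only [ContinuousLinearMap.comp_apply, map_sub, hcomm]
        abel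
      · refine hη _ ?_
        rw [← Real.toNNReal_coe (r := τ)]
        exact Real.toNNReal_le_toNNReal (hs.2.trans (NNReal.coe_le_coe.2 ht))
  have hrange : DenseRange R := by
    refine hAd.mono ?_
    rintro _ ⟨p, hp, rfl⟩
    exact ⟨_, hRA p hp⟩
  -- With f near R (R g), the error splits into five parts: two from the approximation, the
  -- discrepancy at T t (R g), `hcore`, and the discrepancy at R g carried along by S n t.
  obtain ⟨g, hg⟩ := (hrange.comp hrange R.continuous).exists_dist_lt f
    (show 0 < ε / 5 by positivity)
  rw [dist_eq_norm] at hg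
  simp only [Function.comp] at hg
  filter_upwards [hunif g (ε / (5 * (τ + 1))) (by positivity), hunif (R g) (ε / 5) (by positivity)]
    with n h1 h2 t ht
  have h3 : ‖Q n (π n (T t (R g))) - S n t (Q n (π n (R g)))‖ ≤ ε / 5 := by
    refine (hcore g n _ h1 t ht).trans ?_
    rw [div_mul_eq_mul_div, div_le_div_iff₀ (by positivity) (by positivity)]
    have : (t : ℝ) ≤ τ := ht
    nlinarith
  have h4 := h2 t ht
  have h5 : ‖S n t (π n (R (R g)) - Q n (π n (R g)))‖ ≤ ε / 5 := by
    refine (hSc n t _).trans ?_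
    have := h2 0 zero_le
    rwa [hT.1.map_zero] at this
  have h6 : ‖π n (T t (f - R (R g)))‖ ≤ ε / 5 := ((hπ n _).trans (hTc t _)).trans hg.le
  have h7 : ‖S n t (π n (f - R (R g)))‖ ≤ ε / 5 := ((hSc n t _).trans (hπ n _)).trans hg.le
  have e : π n (T t f) - S n t (π n f) = π n (T t (f - R (R g))) - S n t (π n (f - R (R g))) +
      (π n (R (T t (R g))) - Q n (π n (T t (R g)))) +
      (Q n (π n (T t (R g))) - S n t (Q n (π n (R g)))) -
      S n t (π n (R (R g)) - Q n (π n (R g))) := by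
    simp only [map_sub, hcomm]; abel
  rw [e]
  refine (norm_sub_le _ _).trans ?_
  have a1 := norm_add_le (π n (T t (f - R (R g))) - S n t (π n (f - R (R g))) +
      (π n (R (T t (R g))) - Q n (π n (T t (R g)))))
      (Q n (π n (T t (R g))) - S n t (Q n (π n (R g))))
  have a2 := norm_add_le (π n (T t (f - R (R g))) - S n t (π n (f - R (R g))))
      (π n (R (T t (R g))) - Q n (π n (T t (R g))))
  have a3 := norm_sub_le (π n (T t (f - R (R g)))) (S n t (π n (f - R (R g))))
  simp only [hNdef] at h4
  linarith

end TrotterKato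

/-! ### The embeddings -/

section Embedding

variable {μ ν : MassDistribution} {b : BoundaryCondition}

theorem gapLinear_congr {F G : I → ℝ} (h : EqOn F G μ.supp) :
    gapLinear μ.supp F = gapLinear μ.supp G := by
  ext x
  simp only [gapLinear, h (gapLeft_mem Measure.isClosed_support μ.zero_mem x),
    h (gapRight_mem Measure.isClosed_support μ.one_mem x)]

/-- A function whose second derivative is a density with respect to `μ` is linear on the gaps of
the support of `μ`. -/
theorem gapLinear_eq_self {g : I → ℝ} (hg : Integrable g μ.meas) {F F' : C(I, ℝ)}
    (hF : HasDerivOnI F F') (hF' : ∀ x : I, F' x = F' 0 + ∫ y in Iic x, g y ∂μ.meas) :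
    gapLinear μ.supp F = F := by
  ext x
  by_cases hx : x ∈ μ.supp
  · exact gapLinear_of_mem _ hx
  set l := gapLeft μ.supp x with hl
  set r := gapRight μ.supp x with hr
  have hlx : l < x := (gapLeft_le _ x).lt_of_ne fun h =>
    hx (h ▸ gapLeft_mem Measure.isClosed_support μ.zero_mem x)
  have hxr : x < r := (le_gapRight _ x).lt_of_ne fun h =>
    hx (h ▸ gapRight_mem Measure.isClosed_support μ.one_mem x)
  -- The open gap misses the support and its end point is no atom. Hence F' is constant across the
  -- gap.
  have hnull : μ.meas (Ioc l r) = 0 := by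
    rw [← measure_congr (Ioo_ae_eq_Ioc (μ := μ.meas))]
    refine measure_mono_null (t := μ.suppᶜ) (fun y hy hys => ?_) (mem_ae_iff.1 (Measure.support_mem_ae (μ := μ.meas)))
    rcases le_total y x with h | h
    · exact (not_lt.2 (le_gapLeft hys h)) hy.1
    · exact (not_lt.2 (gapRight_le hys h)) hy.2
  have hconst : ∀ y, l ≤ y → y ≤ r → F' y = F' l := by
    intro y hly hyr
    have h0 : ∫ z in Ioc l y, g z ∂μ.meas = 0 :=
      setIntegral_measure_zero _ (measure_mono_null (Ioc_subset_Ioc_right hyr) hnull)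
    rw [hF' y, hF' l, ← Iic_union_Ioc_eq_Iic hly,
      setIntegral_union (Iic_disjoint_Ioc le_rfl) measurableSet_Ioc hg.integrableOn hg.integrableOn,
      h0, add_zero]
  have hlin : ∀ y, l ≤ y → y ≤ r → F y - F l = ((y : ℝ) - l) * F' l := by
    intro y hly hyr
    have hly' : (l : ℝ) ≤ y := hly
    rw [← hF.integral_eq l y hly, ← smul_eq_mul, ← intervalIntegral.integral_const]
    refine intervalIntegral.integral_congr fun t ht => ?_
    rw [uIcc_of_le hly'] at ht
    have ht' : t ∈ Icc (0 : ℝ) 1 := ⟨l.2.1.trans ht.1, ht.2.trans y.2.2⟩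
    rw [IccExtend_of_mem _ _ ht']
    exact hconst ⟨t, ht'⟩ ht.1 (le_trans (show (⟨t, ht'⟩ : I) ≤ y from ht.2) hyr)
  have h1 := hlin x hlx.le hxr.le
  have h2 := hlin r (hlx.trans hxr).le le_rfl
  have h3 : ((r : ℝ) - l) ≠ 0 := sub_ne_zero.2 (show (l : ℝ) < r from hlx.trans hxr).ne'
  simp only [gapLinear, ← hl, ← hr]
  rw [h2]
  field_simp
  linarith

namespace CSpace

theorem linearRep_eq_of_ae {f : CSpace μ b} {F : C(I, ℝ)} (hF : (F : I → ℝ) =ᵐ[μ.meas] toL2 f) :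
    (f.linearRep : I → ℝ) = gapLinear μ.supp F :=
  gapLinear_congr (eqOn_supp ((rep_ae f).trans hF.symm))

theorem linearRep_ae (f : CSpace μ b) : (f.linearRep : I → ℝ) =ᵐ[μ.meas] toL2 f :=
  (ae_of_eqOn_supp (G := f.rep) fun _ hx => gapLinear_of_mem _ hx).trans (rep_ae f)

theorem abs_linearRep_le (f : CSpace μ b) (x : I) : |f.linearRep x| ≤ ‖f‖ := by
  have h : ∀ y ∈ μ.supp, f.rep y ∈ Icc (-‖f‖) ‖f‖ := fun y hy =>
    abs_le.1 ((restrictSupp f).norm_coe_le_norm ⟨y, hy⟩)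
  exact abs_le.2 (gapLinear_mem (convex_Icc _ _)
    (h _ (gapLeft_mem Measure.isClosed_support μ.zero_mem x))
    (h _ (gapRight_mem Measure.isClosed_support μ.one_mem x)))

theorem linearRep_add (f g : CSpace μ b) : (f + g).linearRep = f.linearRep + g.linearRep := by
  have h : ((f.rep + g.rep : C(I, ℝ)) : I → ℝ) =ᵐ[μ.meas] toL2 (f + g) := by
    rw [map_add]
    filter_upwards [rep_ae f, rep_ae g, Lp.coeFn_add (toL2 f) (toL2 g)] with y h1 h2 h3
    rw [h3]; simp [h1, h2]
  ext x
  rw [congrFun (linearRep_eq_of_ae h) x]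
  simp only [linearRep, gapLinear, ContinuousMap.add_apply, ContinuousMap.coe_mk]
  ring

theorem linearRep_smul (c : ℝ) (f : CSpace μ b) : (c • f).linearRep = c • f.linearRep := by
  have h : ((c • f.rep : C(I, ℝ)) : I → ℝ) =ᵐ[μ.meas] toL2 (c • f) := by
    rw [map_smul]
    filter_upwards [rep_ae f, Lp.coeFn_smul c (toL2 f)] with y h1 h3
    rw [h3]; simp [h1]
  ext x
  rw [congrFun (linearRep_eq_of_ae h) x]
  simp only [linearRep, gapLinear, ContinuousMap.smul_apply, ContinuousMap.coe_mk, smul_eq_mul]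
  ring

theorem norm_ofCont_le (F : C(I, ℝ)) (hF : b.OnContinuous F) :
    ‖(ofCont F hF : CSpace μ b)‖ ≤ ‖F‖ :=
  (norm_le_iff (norm_nonneg F) (ofCont_ae F hF)).2 (Eventually.of_forall F.norm_coe_le_norm)

theorem ofCont_sub {F G : C(I, ℝ)} (hF : b.OnContinuous F) (hG : b.OnContinuous G)
    (hFG : b.OnContinuous (F - G)) :
    (ofCont F hF - ofCont G hG : CSpace μ b) = ofCont (F - G) hFG :=
  ext_toL2 (by rw [map_sub, toL2_ofCont, toL2_ofCont, toL2_ofCont, map_sub])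

end CSpace

theorem embed_eq_ofCont (f : CSpace μ b) :
    embed μ ν b f = CSpace.ofCont f.linearRep f.linearRep_onContinuous := rfl

theorem norm_embed_le (f : CSpace μ b) : ‖embed μ ν b f‖ ≤ ‖f‖ :=
  (CSpace.norm_ofCont_le f.linearRep f.linearRep_onContinuous).trans
    ((ContinuousMap.norm_le _ (norm_nonneg f)).2 f.abs_linearRep_le)

/-- The embedding as a continuous linear map. -/
def embedL (μ ν : MassDistribution) (b : BoundaryCondition) : CSpace μ b →L[ℝ] CSpace ν b :=
  LinearMap.mkContinuous
    { toFun := embed μ ν b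
      map_add' := fun f g => CSpace.ext_toL2 (by
        simp only [map_add, embed_eq_ofCont, CSpace.toL2_ofCont, CSpace.linearRep_add])
      map_smul' := fun c f => CSpace.ext_toL2 (by
        simp only [map_smul, embed_eq_ofCont, CSpace.toL2_ofCont, CSpace.linearRep_smul,
          RingHom.id_apply]) }
    1 fun f => by
      rw [one_mul]
      exact norm_embed_le f

theorem embedL_apply (f : CSpace μ b) : embedL μ ν b f = embed μ ν b f := rfl

theorem norm_embedL_le (f : CSpace μ b) : ‖embedL μ ν b f‖ ≤ ‖f‖ := norm_embed_le f

end Embedding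

/-! ### Convergence of resolvents -/

section ResolventConvergence

variable {μ ν : MassDistribution} {b : BoundaryCondition}

theorem BoundaryCondition.OnContinuous.sub {F G : C(I, ℝ)} (hF : b.OnContinuous F)
    (hG : b.OnContinuous G) : b.OnContinuous (F - G) := by
  cases b
  · trivial
  · exact ⟨by simp [hF.1, hG.1], by simp [hF.2, hG.2]⟩

/-- Stability: an approximate solution of the resolvent equation is close to the solution. -/
theorem norm_ofCont_sub_le_of_approx {F f P k : C(I, ℝ)} (hF : b.OnContinuous F)
    (hf : b.OnContinuous f) (hP : b.OnContinuous P) (hk : b.OnContinuous k)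
    (hPk : ((CSpace.ofCont P hP, CSpace.ofCont k hk) : CSpace ν b × CSpace ν b) ∈
      kreinFellerBarSubmodule ν b)
    {q : CSpace ν b × CSpace ν b} (hq : q ∈ kreinFellerBarSubmodule ν b)
    (hqf : q.1 - q.2 = CSpace.ofCont f hf) :
    ‖CSpace.ofCont F hF - q.1‖ ≤ ‖F - P‖ + ‖P - k - f‖ := by
  -- The resolvent equation maps the difference of the two pairs to the residual P - k - f.
  have h1 := kreinFellerBar_dissipative _ (sub_mem hPk hq) 1 zero_le_one
  have h2 : (((CSpace.ofCont P hP, CSpace.ofCont k hk) : CSpace ν b × CSpace ν b) - q).1 -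
      (1 : ℝ) • (((CSpace.ofCont P hP, CSpace.ofCont k hk) : CSpace ν b × CSpace ν b) - q).2 =
      CSpace.ofCont (P - k - f) ((hP.sub hk).sub hf) := by
    rw [← CSpace.ofCont_sub (hP.sub hk) hf, ← CSpace.ofCont_sub hP hk, ← hqf, one_smul,
      Prod.fst_sub, Prod.snd_sub]
    abel
  rw [h2] at h1
  have h3 := h1.trans (CSpace.norm_ofCont_le _ _)
  have h4 : CSpace.ofCont F hF - q.1 =
      CSpace.ofCont (F - P) (hF.sub hP) + (CSpace.ofCont P hP - q.1) := by
    rw [← CSpace.ofCont_sub hF hP]; abel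
  rw [h4]
  exact (norm_add_le _ _).trans (add_le_add (CSpace.norm_ofCont_le _ _) h3)

theorem mem_kreinFellerBar_of {P P' k : C(I, ℝ)} (hP : b.OnContinuous P) (hk : b.OnContinuous k)
    (hd : HasDerivOnI P P') (hP' : ∀ x : I, P' x = P' 0 + ∫ y in Iic x, k y ∂ν.meas)
    (hb : b.OnDomain P P') :
    ((CSpace.ofCont P hP, CSpace.ofCont k hk) : CSpace ν b × CSpace ν b) ∈
      kreinFellerBarSubmodule ν b := by
  refine ⟨P, P', CSpace.ofCont_ae P hP, hd, fun x => ?_, hb⟩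
  rw [hP' x]
  congr 1
  exact integral_congr_ae (ae_restrict_of_ae (CSpace.ofCont_ae k hk))

theorem norm_potential_one_le (ν : MassDistribution) :
    ‖potential (ν.integrable_cont 1)‖ ≤ 1 := by
  rw [ContinuousMap.norm_le _ zero_le_one]
  intro x
  change ‖∫ y, positivePartKernel x y * (1 : C(I, ℝ)) y ∂ν.meas‖ ≤ 1
  have h : ∀ y, ‖positivePartKernel x y * (1 : C(I, ℝ)) y‖ ≤ 1 := fun y => by
    simpa using ((positivePartKernel x).norm_coe_le_norm y).trans (norm_positivePartKernel_le x)
  simpa using norm_integral_le_of_norm_le_const (μ := ν.meas) (Eventually.of_forall h)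

theorem tendsto_integral_of_tendsto {μn : ℕ → MassDistribution}
    (hweak : Tendsto (fun n => (μn n).prob) atTop (𝓝 μ.prob)) (φ : C(I, ℝ)) :
    Tendsto (fun n => ∫ y, φ y ∂(μn n).meas - ∫ y, φ y ∂μ.meas) atTop (𝓝 0) := by
  have := ProbabilityMeasure.tendsto_iff_forall_integral_tendsto.1 hweak
    (BoundedContinuousFunction.mkOfCompact φ)
  simpa using this.sub_const (∫ y, φ y ∂μ.meas)

/-- The value at x is the difference of the integrals of (x - y)⁺ k(y). As x varies these integrands
form a compact subset of C(I), on which weak convergence is uniform. -/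
theorem tendsto_norm_potential_sub {μn : ℕ → MassDistribution}
    (hweak : Tendsto (fun n => (μn n).prob) atTop (𝓝 μ.prob)) (k : C(I, ℝ)) {ε : ℝ} (hε : 0 < ε) :
    ∀ᶠ n in atTop,
      ‖potential ((μn n).integrable_cont k) - potential (μ.integrable_cont k)‖ ≤ ε := by
  have hlip : ∀ (n : ℕ) (φ ψ : C(I, ℝ)), |(∫ y, φ y ∂(μn n).meas - ∫ y, φ y ∂μ.meas) -
      (∫ y, ψ y ∂(μn n).meas - ∫ y, ψ y ∂μ.meas)| ≤ 2 * dist φ ψ := by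
    intro n φ ψ
    have h1 : ∀ ρ : MassDistribution, |∫ y, φ y ∂ρ.meas - ∫ y, ψ y ∂ρ.meas| ≤ dist φ ψ := by
      intro ρ
      rw [← integral_sub (ρ.integrable_cont φ) (ρ.integrable_cont ψ), dist_eq_norm]
      simpa using norm_integral_le_of_norm_le_const (μ := ρ.meas)
        (Eventually.of_forall fun y => (φ - ψ).norm_coe_le_norm y)
    rw [sub_sub_sub_comm]
    have := abs_sub (∫ y, φ y ∂(μn n).meas - ∫ y, ψ y ∂(μn n).meas)
      (∫ y, φ y ∂μ.meas - ∫ y, ψ y ∂μ.meas)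
    linarith [h1 (μn n), h1 μ]
  have hK : IsCompact (range fun x : I => positivePartKernel x * k) :=
    isCompact_range (positivePartKernel.continuous.mul continuous_const)
  filter_upwards [eventually_forall_abs_le_of_isCompact zero_le_two hlip
    (tendsto_integral_of_tendsto hweak) hK hε] with n hn
  rw [ContinuousMap.norm_le _ hε.le]
  exact fun x => hn _ ⟨x, rfl⟩

/-- The natural candidate for the solution of the resolvent equation with `μ` replaced by `ν`. -/
theorem exists_approximate_solution {F F' k : C(I, ℝ)} (hd : HasDerivOnI F F')
    (hF' : ∀ x : I, F' x = F' 0 + ∫ y in Iic x, k y ∂μ.meas) (hb : b.OnDomain F F')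
    (hkb : b.OnContinuous k) {η : ℝ}
    (hη : ‖potential (ν.integrable_cont k) - potential (μ.integrable_cont k)‖ ≤ η)
    (hη' : |∫ y, k y ∂ν.meas - ∫ y, k y ∂μ.meas| ≤ η) :
    ∃ (P m : C(I, ℝ)) (hP : b.OnContinuous P) (hm : b.OnContinuous m),
      ((CSpace.ofCont P hP, CSpace.ofCont m hm) : CSpace ν b × CSpace ν b) ∈
        kreinFellerBarSubmodule ν b ∧ ‖F - P‖ ≤ 2 * η ∧ ‖k - m‖ ≤ η := by
  set δ := potential (ν.integrable_cont k) - potential (μ.integrable_cont k) with hδ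
  have hη0 : 0 ≤ η := (norm_nonneg _).trans hη
  have hEd := hd.add ((hasDerivOnI_potential (ν.integrable_cont k)).sub
    (hasDerivOnI_potential (μ.integrable_cont k)))
  have hcum : ∀ x, F' x = F' 0 + cumulative (μ.integrable_cont k) x := hF'
  have hcum0 := cumulative_zero (ν.integrable_cont k)
  have hcum0' := cumulative_zero (μ.integrable_cont k)
  cases b
  -- Neumann: k has μ-mean zero but ν-mean e. Lowering the density by e restores P'(1) = 0 and
  -- subtracts e times the potential of 1.
  · set e := ∫ y, k y ∂ν.meas with he
    have hke : ∫ y, k y ∂μ.meas = 0 := by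
      have h1 := hcum 1
      rwa [hb.1, hb.2, cumulative_one, zero_add, eq_comm] at h1
    rw [hke, sub_zero] at hη'
    have hd2 := hEd.sub ((hasDerivOnI_potential (ν.integrable_cont 1)).smul e)
    have hcum1 := cumulative_zero (ν.integrable_cont 1)
    refine ⟨_, k - ContinuousMap.const I e, trivial, trivial,
      mem_kreinFellerBar_of _ _ hd2 (fun x => ?_) ⟨?_, ?_⟩, ?_, ?_⟩
    · have h1 : ∫ y in Iic x, (k - ContinuousMap.const I e) y ∂ν.meas =
          cumulative (ν.integrable_cont k) x - e * cumulative (ν.integrable_cont 1) x := by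
        change ∫ y in Iic x, (k y - e) ∂ν.meas =
          ∫ y in Iic x, k y ∂ν.meas - e * ∫ y in Iic x, (1 : C(I, ℝ)) y ∂ν.meas
        rw [← integral_const_mul, integral_sub (ν.integrable_cont k).integrableOn
          (integrable_const _).integrableOn]
        simp
      rw [h1]
      simp only [ContinuousMap.add_apply, ContinuousMap.sub_apply, ContinuousMap.smul_apply,
        smul_eq_mul, hcum0, hcum0', hcum1]
      rw [hcum x]; ring
    · simp only [ContinuousMap.add_apply, ContinuousMap.sub_apply, ContinuousMap.smul_apply,
        smul_eq_mul, hcum0, hcum0', hcum1, hb.1]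
      ring
    · simp only [ContinuousMap.add_apply, ContinuousMap.sub_apply, ContinuousMap.smul_apply,
        smul_eq_mul, cumulative_one, hb.2, hke, ← he]
      simp
    · rw [← hδ, show F - (F + δ - e • potential (ν.integrable_cont 1)) =
        e • potential (ν.integrable_cont 1) - δ by abel]
      refine (norm_sub_le _ _).trans ?_
      rw [norm_smul, Real.norm_eq_abs]
      have := mul_le_mul hη' (norm_potential_one_le ν) (norm_nonneg _) hη0
      linarith
    · rw [sub_sub_cancel, ContinuousMap.norm_le _ hη0]
      exact fun _ => hη'
  -- Dirichlet: the density stays k, and the linear function δ(1) x restores the value 0 at 1.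
  · have hd2 := hEd.sub (hasDerivOnI_coordI.smul (δ 1))
    have h0 : coordI 0 = 0 := rfl
    have h1 : coordI 1 = 1 := rfl
    have hδ0 : δ 0 = 0 := by simp [hδ, potential_zero]
    have hdom : (F + δ - δ 1 • coordI) 0 = 0 ∧ (F + δ - δ 1 • coordI) 1 = 0 :=
      ⟨by simp [hb.1, h0, hδ0], by simp [hb.2, h1]⟩
    refine ⟨F + δ - δ 1 • coordI, k, hdom, hkb, mem_kreinFellerBar_of _ _ hd2 (fun x => ?_) hdom,
      ?_, ?_⟩
    · rw [show ∫ y in Iic x, k y ∂ν.meas = cumulative (ν.integrable_cont k) x from rfl]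
      simp only [ContinuousMap.add_apply, ContinuousMap.sub_apply, ContinuousMap.smul_apply,
        smul_eq_mul, hcum0, hcum0']
      rw [hcum x]
      simp only [ContinuousMap.one_apply]
      ring
    · rw [show F - (F + δ - δ 1 • coordI) = δ 1 • coordI - δ by abel]
      refine (norm_sub_le _ _).trans ?_
      have h2 : ‖coordI‖ ≤ 1 := by
        rw [ContinuousMap.norm_le _ zero_le_one]
        intro x
        change |(x : ℝ)| ≤ 1
        rw [abs_of_nonneg x.2.1]
        exact x.2.2
      rw [norm_smul]
      have := mul_le_mul ((δ.norm_coe_le_norm 1).trans hη) h2 (norm_nonneg _) hη0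
      linarith
    · simpa using hη0

theorem tendsto_resolvent {μn : ℕ → MassDistribution}
    (hweak : Tendsto (fun n => (μn n).prob) atTop (𝓝 μ.prob)) (f : CSpace μ b)
    (p : CSpace μ b × CSpace μ b) (hp : p ∈ kreinFellerBarSubmodule μ b) (hpf : p.1 - p.2 = f)
    (q : ∀ n, CSpace (μn n) b × CSpace (μn n) b)
    (hq : ∀ n, q n ∈ kreinFellerBarSubmodule (μn n) b)
    (hqf : ∀ n, (q n).1 - (q n).2 = embedL μ (μn n) b f) :
    Tendsto (fun n => ‖embedL μ (μn n) b p.1 - (q n).1‖) atTop (𝓝 0) := by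
  obtain ⟨F, F', hF, hd, hF', hb⟩ := hp
  change (F : I → ℝ) =ᵐ[μ.meas] CSpace.toL2 p.1 at hF
  change ∀ x : I, F' x = F' 0 + ∫ y in Iic x, CSpace.toL2 p.2 y ∂μ.meas at hF'
  -- This representative of Δ p.1 satisfies F - k = `f.linearRep` on all of [0,1], not only on the
  -- support of μ, so the equation can be compared with the one for μ_n.
  set k : C(I, ℝ) := F - f.linearRep with hk
  have hkb : b.OnContinuous k := hb.onContinuous.sub f.linearRep_onContinuous
  have hkae : (k : I → ℝ) =ᵐ[μ.meas] CSpace.toL2 p.2 := by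
    have h1 : CSpace.toL2 p.2 = CSpace.toL2 p.1 - CSpace.toL2 f := by
      rw [← map_sub, ← hpf, sub_sub_cancel]
    rw [h1]
    filter_upwards [hF, f.linearRep_ae, Lp.coeFn_sub (CSpace.toL2 p.1) (CSpace.toL2 f)]
      with y h2 h3 h4
    rw [h4, Pi.sub_apply, ← h3, ← h2]
    rfl
  have hF'k : ∀ x : I, F' x = F' 0 + ∫ y in Iic x, k y ∂μ.meas := fun x => by
    rw [hF' x]
    congr 1
    exact integral_congr_ae (ae_restrict_of_ae hkae.symm)
  have hpF : p.1.linearRep = F := by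
    ext x
    rw [congrFun (CSpace.linearRep_eq_of_ae hF) x,
      congrFun (gapLinear_eq_self (μ.integrable_cont k) hd hF'k) x]
  have hembed : ∀ n, embedL μ (μn n) b p.1 = CSpace.ofCont F hb.onContinuous := fun n =>
    CSpace.ext_toL2 (by
      rw [embedL_apply, embed_eq_ofCont, CSpace.toL2_ofCont, CSpace.toL2_ofCont, hpF])
  rw [Metric.tendsto_nhds]
  intro ε hε
  -- With η = ε / 6 the total is 2 ‖F - P‖ + ‖k - m‖ ≤ 5η < ε.
  have hint := (Metric.tendsto_nhds.1 (tendsto_integral_of_tendsto hweak k)) (ε / 6) (by positivity)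
  filter_upwards [tendsto_norm_potential_sub hweak k (show 0 < ε / 6 by positivity), hint]
    with n h1 h2
  rw [Real.dist_eq, sub_zero] at h2
  obtain ⟨P, m, hP, hm, hmem, hFP, hkm⟩ :=
    exists_approximate_solution hd hF'k hb hkb h1 h2.le
  have h3 := norm_ofCont_sub_le_of_approx hb.onContinuous f.linearRep_onContinuous hP hm hmem
    (hq n) (hqf n)
  have h4 : ‖P - m - f.linearRep‖ ≤ ‖F - P‖ + ‖k - m‖ := by
    have : P - m - f.linearRep = (k - m) - (F - P) := by rw [hk]; abel
    rw [this, add_comm]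
    exact norm_sub_le _ _
  rw [hembed, Real.dist_eq, sub_zero, abs_norm]
  linarith

end ResolventConvergence
end KreinFeller

end

/-! ### The main theorem. -/

open KreinFeller
theorem theorem5p10 (b : BoundaryCondition) (μ : MassDistribution) (μn : ℕ → MassDistribution)
    (hweak : Tendsto (fun n => (μn n).prob) atTop (𝓝 μ.prob))
    (hsupp : ∀ n, μ.supp ⊆ (μn n).supp)
    (f : CSpace μ b) :
    Generates (kreinFeller μ b) (heatSemigroup μ b) ∧
    (∀ n, Generates (kreinFeller (μn n) b) (heatSemigroup (μn n) b)) ∧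
    ∃ (u : ℝ≥0 → CSpace μ b) (un : ∀ n, ℝ≥0 → CSpace (μn n) b),
      (IsSolution (kreinFellerBar μ b) f u ∧
        (∀ v, IsSolution (kreinFellerBar μ b) f v → v = u) ∧
        ∀ t, CSpace.toL2 (u t) = heatSemigroup μ b t (CSpace.toL2 f)) ∧
      (∀ n, IsSolution (kreinFellerBar (μn n) b) (embed μ (μn n) b f) (un n) ∧
        (∀ v, IsSolution (kreinFellerBar (μn n) b) (embed μ (μn n) b f) v → v = un n) ∧
        ∀ t, CSpace.toL2 (un n t) =
          heatSemigroup (μn n) b t (CSpace.toL2 (embed μ (μn n) b f))) ∧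
      ∀ τ : ℝ≥0, TendstoUniformlyOn (fun n t => ‖embed μ (μn n) b (u t) - un n t‖)
        (fun _ => 0) atTop (Set.Iic τ) := by
  obtain ⟨T, hT, hTc⟩ := exists_generates_kreinFellerBar μ b
  choose S hS hSc using fun n => exists_generates_kreinFellerBar (μn n) b
  refine ⟨generates_heatSemigroup μ b, fun n => generates_heatSemigroup (μn n) b,
    fun t => T t f, fun n t => S n t (embed μ (μn n) b f),
    ⟨isSolution_kreinFellerBar hT f, fun v hv => ?_, fun t => toL2_semigroup hT t f⟩,
    fun n => ⟨isSolution_kreinFellerBar (hS n) _, fun v hv => ?_,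
      fun t => toL2_semigroup (hS n) t _⟩, fun τ => ?_⟩
  · exact IsSolution.eq_of_dissipative kreinFellerBar_dissipative hv
      (isSolution_kreinFellerBar hT f)
  · exact IsSolution.eq_of_dissipative kreinFellerBar_dissipative hv
      (isSolution_kreinFellerBar (hS n) _)
  · rw [Metric.tendstoUniformlyOn_iff]
    intro ε hε
    filter_upwards [trotter_kato (A := kreinFellerBarSubmodule μ b)
      (B := fun n => kreinFellerBarSubmodule (μn n) b) kreinFellerBar_dissipative
      (fun n => kreinFellerBar_dissipative) kreinFellerBar_dense
      (kreinFellerBar_surjective 1 one_pos) (fun n => kreinFellerBar_surjective 1 one_pos)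
      hT hS hTc hSc (π := fun n => embedL μ (μn n) b) (fun n => norm_embedL_le)
      (tendsto_resolvent hweak) f τ (half_pos hε)] with n hn t ht
    rw [dist_zero_left, norm_norm]
    exact (hn t ht).trans_lt (half_lt_self hε)
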